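/- Let $\mathrm{ZFGC}^{-f}$ be the first-order theory in the language $\{\in, C\}$, $C$ a unary function symbol, whose axioms are all axioms of ZFC except foundation (extensionality, pairing, union, power set, infinity, choice, and the separation and collection schemes, the schemes for all formulas of the expanded language), together with the assertion that $C$ restricted to the class of ordinals (transitive sets well-ordered by $\in$) is a bijection from $\mathrm{Ord}$ onto the class $V$ of all sets. Let $\mathrm{BAFA}$ be Boffa's axiom: for every transitive set $t_0$ and every extensional binary relation $\langle a,e\rangle$ with $t_0\subseteq a$ and ${\in}\restriction t_0=e\cap(a\times t_0)$, there are a transitive set $t$ and an isomorphism from $\langle a,e\rangle$ onto $\langle t,\in\rangle$ that is the identity on $t_0$. **Theorem (scheme).** There is a formula $J(x,y)$ of the language $\{\in,C\}$, without parameters, such that the theory $\mathrm{ZFGC}^{-f}+\mathrm{BAFA}$ proves that $J$ defines a class function $j\colon V\to V$, proves for each formula $\varphi(x_1,\dots,x_n)$ of the language $\{\in\}$ that $\varphi(x_1,\dots,x_n)\leftrightarrow\varphi(j(x_1),\dots,j(x_n))$ for all sets $x_1,\dots,x_n$, and proves that $j$ is not an automorphism of $\langle V,\in\rangle$. Equivalently: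 in every model $\langle M,\in,C\rangle$ of $\mathrm{ZFGC}^{-f}+\mathrm{BAFA}$, the formula $J$ defines an elementary embedding $j\colon\langle M,\in\rangle\to\langle M,\in\rangle$ that is not an automorphism of $\langle M,\in\rangle$. Moreover, $J$ can be chosen so that the theory also proves the following. Let $A=(V\times\{0\})\cup\{a\}$ with $a=\langle 1,1\rangle$, and $E=\{\langle\langle x,0\rangle,\langle y,0\rangle\rangle : x\in y\}\cup\{\langle a,a\rangle\}$ (the disjoint union of a copy of $V$ and one additional Quine atom). Then there is a set $q$ such that the class map $F$ on $A$ given by $F(\langle x,0\rangle)=j(x)$ and $F(a)=q$ is an isomorphism of $\langle A,E\rangle$ onto $\langle T,\in\rangle$ for a transitive class $T$. -/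

import Mathlib

open FirstOrder

universe u

namespace BoffaTheory

/-- The only relation symbol of the language of set theory: a binary membership symbol. -/
inductive MemRel : ℕ → Type
  | mem : MemRel 2

/-- The only additional function symbol: a unary symbol for the global choice function. -/
inductive ChoiceFun : ℕ → Type
  | choice : ChoiceFun 1

/-- The first-order language of set theory (equality is built into the logic). -/
def memLang : FirstOrder.Language.{0, 0} := ⟨fun _ => Empty, MemRel⟩

/-- The language with the single unary function symbol `C`. -/
def choiceLang : FirstOrder.Language.{0, 0} := ⟨ChoiceFun, fun _ => Empty⟩

/-- The language of set theory expanded by the function symbol `C`. -/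
abbrev gcLang : FirstOrder.Language.{0, 0} := memLang.sum choiceLang

section Membership

variable {M : Type u} [memLang.Structure M]

/-- Membership in the sense of the structure `M`. -/
def Mem (x y : M) : Prop :=
  FirstOrder.Language.Structure.RelMap (L := memLang) (M := M) MemRel.mem ![x, y]

infix:50 " ∈ₛ " => Mem

/-- `a ⊆ b`. -/
def Sub (a b : M) : Prop := ∀ z, z ∈ₛ a → z ∈ₛ b

/-- `t` is a transitive set. -/
def TransSet (t : M) : Prop := ∀ x y, x ∈ₛ y → y ∈ₛ t → x ∈ₛ t

/-- `c = {x, y}`. -/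
def IsUPair (c x y : M) : Prop := ∀ z, z ∈ₛ c ↔ z = x ∨ z = y

/-- `p = ⟨x, y⟩`, the Kuratowski pair `{{x}, {x, y}}`. -/
def IsOPair (p x y : M) : Prop := ∀ z, z ∈ₛ p ↔ IsUPair z x x ∨ IsUPair z x y

/-- `⟨x, y⟩ ∈ r`: the set `r`, seen as a binary relation, relates `x` to `y`. -/
def Rel (r x y : M) : Prop := ∃ p, IsOPair p x y ∧ p ∈ₛ r

/-- `e ⊆ a × b`. -/
def SubProd (e a b : M) : Prop :=
  ∀ p, p ∈ₛ e → ∃ x y, x ∈ₛ a ∧ y ∈ₛ b ∧ IsOPair p x y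

/-- `α` is a (von Neumann) ordinal: a transitive set well-ordered by `∈`. As foundation is not
available, well-foundedness of `∈` on `α` is required explicitly; applied to sets with at most
three elements, it gives that the total relation `∈` on `α` is irreflexive and transitive. -/
def IsOrd (α : M) : Prop :=
  TransSet α ∧
  (∀ x y, x ∈ₛ α → y ∈ₛ α → x ∈ₛ y ∨ x = y ∨ y ∈ₛ x) ∧
  (∀ s, Sub s α → (∃ z, z ∈ₛ s) → ∃ m, m ∈ₛ s ∧ ∀ z, z ∈ₛ s → ¬ z ∈ₛ m)

/-- `⟨a, e⟩` is an extensional binary relation. -/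
def ExtRel (a e : M) : Prop :=
  SubProd e a a ∧
  ∀ x y, x ∈ₛ a → y ∈ₛ a → (∀ z, z ∈ₛ a → (Rel e z x ↔ Rel e z y)) → x = y

/-- `⟨a, e⟩` end-extends `⟨t, ∈⟩`: `t ⊆ a` and `∈ ↾ t = e ∩ (a × t)`. -/
def EndExtends (a e t : M) : Prop :=
  Sub t a ∧
  ∀ x y, (x ∈ₛ t ∧ y ∈ₛ t ∧ x ∈ₛ y) ↔ (Rel e x y ∧ x ∈ₛ a ∧ y ∈ₛ t)

/-- The set `f` is (the graph of) an isomorphism from `⟨a, e⟩` onto `⟨t, ∈⟩`. -/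
def IsIso (f a e t : M) : Prop :=
  SubProd f a t ∧
  (∀ x, x ∈ₛ a → ∃! y, Rel f x y) ∧
  (∀ y, y ∈ₛ t → ∃! x, Rel f x y) ∧
  (∀ x x' y y', Rel f x y → Rel f x' y' → (Rel e x x' ↔ y ∈ₛ y'))

end Membership

/-- Boffa's axiom of superuniversality: every extensional binary relation `⟨a, e⟩` end-extending a
transitive set `⟨t₀, ∈⟩` is isomorphic to a transitive set by an isomorphism that is the identity
on `t₀`. -/
def BAFA (M : Type u) [memLang.Structure M] : Prop :=
  ∀ t₀ a e : M, TransSet t₀ → ExtRel a e → EndExtends a e t₀ →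
    ∃ t f, TransSet t ∧ IsIso f a e t ∧ ∀ x, x ∈ₛ t₀ → Rel f x x

/-- The interpretation of the function symbol `C` in `M`. -/
def choiceFn {M : Type u} [choiceLang.Structure M] (x : M) : M :=
  FirstOrder.Language.Structure.funMap (L := choiceLang) (M := M) ChoiceFun.choice ![x]

/-- `M` is a model of ZFC without foundation and with global choice, in the language of set theory
with the additional function symbol `C`. The quantifiers of the axioms range over `M`; the two
schemes range over all formulas of the expanded language and all parameters `p`. -/
structure ModelsZFGC (M : Type u) [memLang.Structure M] [choiceLang.Structure M] : Prop where
  extensionality : ∀ a b : M, (∀ z, z ∈ₛ a ↔ z ∈ₛ b) → a = b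
  pairing : ∀ a b : M, ∃ c, IsUPair c a b
  union : ∀ a : M, ∃ b, ∀ z, z ∈ₛ b ↔ ∃ y, y ∈ₛ a ∧ z ∈ₛ y
  power : ∀ a : M, ∃ b, ∀ z, z ∈ₛ b ↔ Sub z a
  infinity : ∃ w : M, (∃ o, (∀ z, ¬ z ∈ₛ o) ∧ o ∈ₛ w) ∧
    ∀ x, x ∈ₛ w → ∃ s, (∀ z, z ∈ₛ s ↔ z ∈ₛ x ∨ z = x) ∧ s ∈ₛ w
  separation : ∀ (n : ℕ) (φ : gcLang.Formula (Fin (n + 1))) (p : Fin n → M) (a : M),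
    ∃ b, ∀ x, x ∈ₛ b ↔ x ∈ₛ a ∧ φ.Realize (Fin.cons x p : Fin (n + 1) → M)
  collection : ∀ (n : ℕ) (φ : gcLang.Formula (Fin (n + 2))) (p : Fin n → M) (a : M),
    (∀ x, x ∈ₛ a → ∃ y, φ.Realize (Fin.cons x (Fin.cons y p : Fin (n + 1) → M))) →
    ∃ b, ∀ x, x ∈ₛ a →
      ∃ y, y ∈ₛ b ∧ φ.Realize (Fin.cons x (Fin.cons y p : Fin (n + 1) → M))
  /-- Every set of nonempty pairwise disjoint sets has a choice set. -/
  choice : ∀ a : M, (∀ x, x ∈ₛ a → ∃ z, z ∈ₛ x) →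
    (∀ x y, x ∈ₛ a → y ∈ₛ a → x ≠ y → ¬ ∃ z, z ∈ₛ x ∧ z ∈ₛ y) →
    ∃ c, ∀ x, x ∈ₛ a → ∃! z, z ∈ₛ x ∧ z ∈ₛ c
  /-- `C` restricted to the class of ordinals is a bijection onto the class of all sets (the values
  of the function symbol outside the ordinals are irrelevant). -/
  globalChoice : ∀ x : M, ∃! α, IsOrd α ∧ choiceFn α = x

/-- The membership relation of `V` plus one extra Quine atom: `some x` stands for the copy
`⟨x, 0⟩` of `x ∈ V`, and `none` for the extra point, whose only element is itself. -/
def plusQuineAtom {M : Type u} [memLang.Structure M] : Option M → Option M → Prop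
  | some x, some y => x ∈ₛ y
  | none, none => True
  | _, _ => False

/-- `F` is an isomorphism of `⟨A, E⟩` onto a transitive class of `M`. -/
def IsTransitiveCollapse {M : Type u} [memLang.Structure M] {A : Type u} (E : A → A → Prop)
    (F : A → M) : Prop :=
  Function.Injective F ∧ (∀ a b, E a b ↔ F a ∈ₛ F b) ∧
    ∀ (z : M) (b : A), z ∈ₛ F b → ∃ a, F a = z

end BoffaTheory

/-! Call a set `f` an embedding (`IsEmb`) when its pairs form an `∈`-isomorphism between two
transitive sets. Under BAFA these set isomorphisms form a back-and-forth system: given `f` and a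
larger transitive domain, copy the new part of the domain as fresh points on top of the range, and
collapse the resulting extensional relation while fixing the range (`exists_extension`). Every such
`f` therefore preserves all formulas of the language of membership (`realize_iff_of_isEmb`),
whatever its range leaves out.

BAFA also gives sets `q = {q}`. Fix the one that comes first in the well-order of `V` induced by
`C`. Along this order, build a coherent sequence of isomorphisms on the transitive closures of
initial segments, each time taking the first set that continues the previous ones and omits `q` from
its range. Omission can always be maintained: `q` is adjoined to the set over which one collapses,
which pushes all new values away from it (`exists_stage`).

The union `j` is total, its range is transitive and omits `q`, so it is not onto. Any finitely many
arguments lie in the domain of one stage, which makes `j` elementary. Since the only member of `q`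
is `q`, the range of `j` together with `q` is transitive and is a copy of `V` plus a Quine atom. -/

namespace BoffaTheory

/-! ### Closure properties of definability, uniform over a family of structures -/

section Definability

universe w w' w''

variable {I : Type w} {M : I → Type u} [∀ i, memLang.Structure (M i)]
  [∀ i, choiceLang.Structure (M i)] {κ : Type w'} {α : Type w''}

/-- The family of functions `t` is the value of one term with parameters from the family `p`. -/
class IsTm (p : ∀ i, κ → M i) (t : ∀ i, (α → M i) → M i) : Prop where
  out : ∃ τ : gcLang.Term (κ ⊕ α), ∀ i v, τ.realize (Sum.elim (p i) v) = t i v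

/-- The family of predicates `P` is defined by one formula with parameters from the family `p`. -/
class IsDef (p : ∀ i, κ → M i) (P : ∀ i, (α → M i) → Prop) : Prop where
  out : ∃ φ : gcLang.Formula (κ ⊕ α), ∀ i v, φ.Realize (Sum.elim (p i) v) ↔ P i v

variable {p : ∀ i, κ → M i}

instance IsTm.var (a : α) : IsTm p (fun _ v => v a) :=
  ⟨.var (.inr a), fun _ _ => rfl⟩

instance IsTm.const {M : Type u} [memLang.Structure M] [choiceLang.Structure M] (c : M) :
    IsTm (I := Unit) (M := fun _ => M) (fun _ m => m) (fun _ (_ : α → M) => c) :=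
  ⟨.var (.inl c), fun _ _ => rfl⟩

instance IsTm.choiceFn {t : ∀ i, (α → M i) → M i} [h : IsTm p t] :
    IsTm p (fun i v => choiceFn (t i v)) := by
  obtain ⟨τ, hτ⟩ := h.out
  refine ⟨.func (Sum.inr ChoiceFun.choice : gcLang.Functions 1) ![τ], fun i v => ?_⟩
  simp only [Language.Term.realize, BoffaTheory.choiceFn, ← hτ]
  show Language.Structure.funMap (L := choiceLang) ChoiceFun.choice _ = _
  congr 1
  funext k
  fin_cases k
  rfl

variable {s t : ∀ i, (α → M i) → M i} {P Q : ∀ i, (α → M i) → Prop}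

instance IsDef.mem [hs : IsTm p s] [ht : IsTm p t] : IsDef p (fun i v => s i v ∈ₛ t i v) := by
  obtain ⟨σ, hσ⟩ := hs.out
  obtain ⟨τ, hτ⟩ := ht.out
  refine ⟨Language.Relations.formula (Sum.inl MemRel.mem : gcLang.Relations 2) ![σ, τ],
    fun i v => ?_⟩
  refine Language.Formula.realize_rel.trans ?_
  rw [Mem, ← hσ, ← hτ]
  show Language.Structure.RelMap (L := memLang) (M := M i) MemRel.mem _ ↔ _
  refine iff_of_eq (congrArg _ ?_)
  funext k
  fin_cases k <;> rfl

instance IsDef.eq [hs : IsTm p s] [ht : IsTm p t] : IsDef p (fun i v => s i v = t i v) := by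
  obtain ⟨σ, hσ⟩ := hs.out
  obtain ⟨τ, hτ⟩ := ht.out
  exact ⟨σ.equal τ, fun i v => by rw [Language.Formula.realize_equal, hσ, hτ]⟩

instance IsDef.not [hP : IsDef p P] : IsDef p (fun i v => ¬ P i v) := by
  obtain ⟨φ, hφ⟩ := hP.out
  exact ⟨φ.not, fun i v => by rw [Language.Formula.realize_not, hφ]⟩

instance IsDef.and [hP : IsDef p P] [hQ : IsDef p Q] : IsDef p (fun i v => P i v ∧ Q i v) := by
  obtain ⟨φ, hφ⟩ := hP.out
  obtain ⟨ψ, hψ⟩ := hQ.out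
  exact ⟨φ ⊓ ψ, fun i v => by rw [Language.Formula.realize_inf, hφ, hψ]⟩

instance IsDef.or [hP : IsDef p P] [hQ : IsDef p Q] : IsDef p (fun i v => P i v ∨ Q i v) := by
  obtain ⟨φ, hφ⟩ := hP.out
  obtain ⟨ψ, hψ⟩ := hQ.out
  exact ⟨φ ⊔ ψ, fun i v => by rw [Language.Formula.realize_sup, hφ, hψ]⟩

instance IsDef.imp [hP : IsDef p P] [hQ : IsDef p Q] : IsDef p (fun i v => P i v → Q i v) := by
  obtain ⟨φ, hφ⟩ := hP.out
  obtain ⟨ψ, hψ⟩ := hQ.out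
  exact ⟨φ.imp ψ, fun i v => by rw [Language.Formula.realize_imp, hφ, hψ]⟩

instance IsDef.iff [hP : IsDef p P] [hQ : IsDef p Q] : IsDef p (fun i v => P i v ↔ Q i v) := by
  obtain ⟨φ, hφ⟩ := hP.out
  obtain ⟨ψ, hψ⟩ := hQ.out
  exact ⟨φ.iff ψ, fun i v => by rw [Language.Formula.realize_iff, hφ, hψ]⟩

/-- The bound variable is the coordinate `none` of an assignment on `Option α`, so that instance
search can pass under quantifiers and certify definability syntactically. -/
instance IsDef.ex {P : ∀ i, (α → M i) → M i → Prop}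
    [hP : IsDef p (fun i (w : Option α → M i) => P i (fun a => w (some a)) (w none))] :
    IsDef p (fun i v => ∃ x, P i v x) := by
  obtain ⟨φ, hφ⟩ := hP.out
  let g : κ ⊕ Option α → (κ ⊕ α) ⊕ Unit :=
    Sum.elim (fun k => .inl (.inl k)) (fun a => a.elim (.inr ()) (fun a => .inl (.inr a)))
  refine ⟨(φ.relabel g).iExs Unit, fun i v => ?_⟩
  rw [Language.Formula.realize_iExs]
  have key : ∀ x : Unit → M i, (φ.relabel g).Realize (Sum.elim (Sum.elim (p i) v) x) ↔
      P i v (x ()) := fun x => by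
    rw [Language.Formula.realize_relabel]
    have := hφ i (fun a => a.elim (x ()) v)
    simp only [Option.elim] at this
    rw [← this]
    apply iff_of_eq
    congr 1
    funext k
    rcases k with k | _ | k <;> rfl
  exact ⟨fun ⟨x, hx⟩ => ⟨_, (key x).1 hx⟩, fun ⟨x, hx⟩ => ⟨fun _ => x, (key _).2 hx⟩⟩

theorem IsDef.congr [hP : IsDef p P] (h : ∀ i v, P i v ↔ Q i v) : IsDef p Q := by
  obtain ⟨φ, hφ⟩ := hP.out
  exact ⟨φ, fun i v => (hφ i v).trans (h i v)⟩

instance IsDef.all {P : ∀ i, (α → M i) → M i → Prop}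
    [hP : IsDef p (fun i (w : Option α → M i) => P i (fun a => w (some a)) (w none))] :
    IsDef p (fun i v => ∀ x, P i v x) :=
  .congr (P := fun i v => ¬ ∃ x, ¬ P i v x) (by simp)

/-- The second premise serves the uniqueness clause, where the predicate occurs beneath two binders
and skips the outer one. -/
instance IsDef.exUnique {P : ∀ i, (α → M i) → M i → Prop}
    [hP : IsDef p (fun i (w : Option α → M i) => P i (fun a => w (some a)) (w none))]
    [hP' : IsDef p (fun i (w : Option (Option α) → M i) =>
      P i (fun a => w (some (some a))) (w none))] :
    IsDef p (fun i v => ∃! x, P i v x) := by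
  unfold ExistsUnique
  infer_instance

/-- Thanks to closure under substitution, each notion is unfolded once, at plain variables, and its
instance then applies to arbitrary terms. -/
theorem IsDef.subst {β : Type*} {P : ∀ i, (β → M i) → Prop} [hP : IsDef p P]
    (t : ∀ i, β → (α → M i) → M i) (ht : ∀ b, IsTm p (fun i v => t i b v)) :
    IsDef p (fun i v => P i (fun b => t i b v)) := by
  obtain ⟨φ, hφ⟩ := hP.out
  choose τ hτ using fun b => (ht b).out
  refine ⟨Language.BoundedFormula.subst φ (Sum.elim (fun k => .var (.inl k)) τ), fun i v => ?_⟩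
  rw [← hφ, Language.Formula.Realize, Language.BoundedFormula.realize_subst,
    Language.Formula.Realize]
  apply iff_of_eq
  congr 1
  funext k
  rcases k with k | b
  · rfl
  · exact hτ b i v

variable {r : ∀ i, (α → M i) → M i}

theorem IsDef.subst₁ {R : ∀ i, M i → Prop} (hR : IsDef p (fun i (v : Fin 1 → M i) => R i (v 0)))
    [hs : IsTm p s] : IsDef p (fun i v => R i (s i v)) :=
  hR.subst (fun i => ![s i]) (by intro b; fin_cases b; exact hs)

theorem IsDef.subst₂ {R : ∀ i, M i → M i → Prop}
    (hR : IsDef p (fun i (v : Fin 2 → M i) => R i (v 0) (v 1)))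
    [hs : IsTm p s] [ht : IsTm p t] : IsDef p (fun i v => R i (s i v) (t i v)) :=
  hR.subst (fun i => ![s i, t i]) (by intro b; fin_cases b <;> assumption)

theorem IsDef.subst₃ {R : ∀ i, M i → M i → M i → Prop}
    (hR : IsDef p (fun i (v : Fin 3 → M i) => R i (v 0) (v 1) (v 2)))
    [hr : IsTm p r] [hs : IsTm p s] [ht : IsTm p t] :
    IsDef p (fun i v => R i (r i v) (s i v) (t i v)) :=
  hR.subst (fun i => ![r i, s i, t i]) (by intro b; fin_cases b <;> assumption)

instance IsDef.sub [IsTm p s] [IsTm p t] : IsDef p (fun i v => Sub (s i v) (t i v)) :=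
  subst₂ (R := fun _ => Sub) (by unfold Sub; infer_instance)

instance IsDef.transSet [IsTm p s] : IsDef p (fun i v => TransSet (s i v)) :=
  subst₁ (R := fun _ => TransSet) (by unfold TransSet; infer_instance)

instance IsDef.isUPair [IsTm p r] [IsTm p s] [IsTm p t] :
    IsDef p (fun i v => IsUPair (r i v) (s i v) (t i v)) :=
  subst₃ (R := fun _ => IsUPair) (by unfold IsUPair; infer_instance)

instance IsDef.isOPair [IsTm p r] [IsTm p s] [IsTm p t] :
    IsDef p (fun i v => IsOPair (r i v) (s i v) (t i v)) :=
  subst₃ (R := fun _ => IsOPair) (by unfold IsOPair; infer_instance)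

instance IsDef.rel [IsTm p r] [IsTm p s] [IsTm p t] :
    IsDef p (fun i v => Rel (r i v) (s i v) (t i v)) :=
  subst₃ (R := fun _ => Rel) (by unfold Rel; infer_instance)

instance IsDef.isOrd [IsTm p s] : IsDef p (fun i v => IsOrd (s i v)) :=
  subst₁ (R := fun _ => IsOrd) (by unfold IsOrd; infer_instance)

end Definability

/-! ### Separation and collection for definable classes -/

section Schemes

variable {M : Type u} [memLang.Structure M] [choiceLang.Structure M]

/-- The predicate `P` on tuples from `M` is definable with parameters. -/
abbrev DefIn (M : Type u) [memLang.Structure M] [choiceLang.Structure M] {α : Type*}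
    (P : (α → M) → Prop) : Prop :=
  IsDef (I := Unit) (M := fun _ => M) (fun _ m => m) (fun _ v => P v)

/-- The class `P` is definable with parameters. -/
abbrev DefIn₁ (P : M → Prop) : Prop := DefIn M (fun v : Fin 1 → M => P (v 0))

/-- The binary class relation `P` is definable with parameters. -/
abbrev DefIn₂ (P : M → M → Prop) : Prop := DefIn M (fun v : Fin 2 → M => P (v 0) (v 1))

/-- A formula mentions only finitely many parameters; enumerating them brings it to the shape that
the schemes require. -/
theorem DefIn.exists_formula {k : ℕ} {P : (Fin k → M) → Prop} (h : DefIn M P) :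
    ∃ (n : ℕ) (p : Fin n → M) (ψ : gcLang.Formula (Fin n ⊕ Fin k)),
      ∀ v, ψ.Realize (Sum.elim p v) ↔ P v := by
  classical
  obtain ⟨φ, hφ⟩ := h.out
  let S : Finset (M ⊕ Fin k) := Language.BoundedFormula.freeVarFinset φ
  let T : Finset M := S.toLeft
  let e := T.equivFin
  let f : S → Fin T.card ⊕ Fin k := fun x => match x with
    | ⟨.inl m, hm⟩ => .inl (e ⟨m, by simpa [T] using hm⟩)
    | ⟨.inr a, _⟩ => .inr a
  refine ⟨T.card, fun i => (e.symm i : M), φ.restrictFreeVar f, fun v => ?_⟩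
  rw [← hφ (), Language.Formula.Realize, Language.Formula.Realize]
  refine Language.BoundedFormula.realize_restrictFreeVar _ ?_
  rintro ⟨m | a, hm⟩ <;> simp [f]

theorem ModelsZFGC.sep (hM : ModelsZFGC M) (a : M) (P : M → Prop) [h : DefIn₁ P] :
    ∃ b, ∀ x, x ∈ₛ b ↔ x ∈ₛ a ∧ P x := by
  obtain ⟨n, p, ψ, hψ⟩ := h.exists_formula
  let g : Fin n ⊕ Fin 1 → Fin (n + 1) := Sum.elim Fin.succ (fun _ => 0)
  obtain ⟨b, hb⟩ := hM.separation n (ψ.relabel g) p a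
  refine ⟨b, fun x => (hb x).trans (and_congr_right fun _ => ?_)⟩
  rw [Language.Formula.realize_relabel]
  refine Iff.trans (iff_of_eq ?_) (hψ ![x])
  congr 1
  funext k
  rcases k with k | k
  · rfl
  · fin_cases k; rfl

theorem ModelsZFGC.coll (hM : ModelsZFGC M) (a : M) (P : M → M → Prop) [h : DefIn₂ P]
    (ht : ∀ x, x ∈ₛ a → ∃ y, P x y) : ∃ b, ∀ x, x ∈ₛ a → ∃ y, y ∈ₛ b ∧ P x y := by
  obtain ⟨n, p, ψ, hψ⟩ := h.exists_formula
  let g : Fin n ⊕ Fin 2 → Fin (n + 2) := Sum.elim (fun k => k.succ.succ) ![0, 1]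
  have key : ∀ x y, (ψ.relabel g).Realize (Fin.cons x (Fin.cons y p : Fin (n + 1) → M)) ↔ P x y := by
    intro x y
    rw [Language.Formula.realize_relabel]
    refine Iff.trans (iff_of_eq ?_) (hψ ![x, y])
    congr 1
    funext k
    rcases k with k | k
    · rfl
    · fin_cases k <;> rfl
  obtain ⟨b, hb⟩ := hM.collection n (ψ.relabel g) p a (fun x hx => by
    obtain ⟨y, hy⟩ := ht x hx
    exact ⟨y, (key x y).2 hy⟩)
  refine ⟨b, fun x hx => ?_⟩
  obtain ⟨y, hy, hy'⟩ := hb x hx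
  exact ⟨y, hy, (key x y).1 hy'⟩

end Schemes

/-! ### Elementary set theory: pairs, relations, images -/

section Sets

variable {M : Type u} [memLang.Structure M]

theorem IsUPair.left {c x y : M} (h : IsUPair c x y) : x ∈ₛ c := (h x).2 (.inl rfl)

theorem IsUPair.right {c x y : M} (h : IsUPair c x y) : y ∈ₛ c := (h y).2 (.inr rfl)

variable [choiceLang.Structure M]

theorem DefIn₁.subst {P : M → Prop} (h : DefIn₁ P) {α : Type} {s : (α → M) → M}
    [hs : IsTm (I := Unit) (M := fun _ => M) (fun _ m => m) (fun _ v => s v)] :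
    DefIn M (fun v => P (s v)) :=
  IsDef.subst₁ (I := Unit) (R := fun _ => P) (s := fun _ v => s v) h

theorem DefIn₂.subst {P : M → M → Prop} (h : DefIn₂ P) {α : Type} {s t : (α → M) → M}
    [hs : IsTm (I := Unit) (M := fun _ => M) (fun _ m => m) (fun _ v => s v)]
    [ht : IsTm (I := Unit) (M := fun _ => M) (fun _ m => m) (fun _ v => t v)] :
    DefIn M (fun v => P (s v) (t v)) :=
  IsDef.subst₂ (I := Unit) (R := fun _ => P) (s := fun _ v => s v) (t := fun _ v => t v) h

namespace ModelsZFGC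

variable (hM : ModelsZFGC M)
include hM

theorem exists_empty : ∃ o : M, ∀ z, ¬ z ∈ₛ o :=
  let ⟨_, ⟨o, ho, _⟩, _⟩ := hM.infinity
  ⟨o, ho⟩

theorem exists_union₂ (a b : M) : ∃ c, ∀ z, z ∈ₛ c ↔ z ∈ₛ a ∨ z ∈ₛ b := by
  obtain ⟨p, hp⟩ := hM.pairing a b
  obtain ⟨c, hc⟩ := hM.union p
  refine ⟨c, fun z => (hc z).trans ?_⟩
  simp only [hp _]
  aesop

theorem exists_singleton (a : M) : ∃ c, ∀ z, z ∈ₛ c ↔ z = a := by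
  obtain ⟨c, hc⟩ := hM.pairing a a
  exact ⟨c, fun z => (hc z).trans (or_self_iff)⟩

theorem exists_insert (a b : M) : ∃ c, ∀ z, z ∈ₛ c ↔ z ∈ₛ a ∨ z = b := by
  obtain ⟨s, hs⟩ := hM.exists_singleton b
  obtain ⟨c, hc⟩ := hM.exists_union₂ a s
  exact ⟨c, fun z => by rw [hc, hs]⟩

theorem exists_opair (x y : M) : ∃ p, IsOPair p x y := by
  obtain ⟨a, ha⟩ := hM.pairing x x
  obtain ⟨b, hb⟩ := hM.pairing x y
  obtain ⟨p, hp⟩ := hM.pairing a b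
  refine ⟨p, fun z => (hp z).trans (or_congr ?_ ?_)⟩
  · exact ⟨fun h => h ▸ ha, fun h => hM.extensionality _ _ fun w => (h w).trans (ha w).symm⟩
  · exact ⟨fun h => h ▸ hb, fun h => hM.extensionality _ _ fun w => (h w).trans (hb w).symm⟩

theorem opair_inj {p x y x' y' : M} (h : IsOPair p x y) (h' : IsOPair p x' y') :
    x = x' ∧ y = y' := by
  have hx : x = x' := by
    obtain ⟨a, ha⟩ := hM.pairing x x
    have hx' : x' ∈ₛ a := by
      rcases (h' a).1 ((h a).2 (.inl ha)) with h1 | h1 <;> exact h1.left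
    exact (((ha _).1 hx').elim id id).symm
  subst hx
  refine ⟨rfl, ?_⟩
  have aux : ∀ {y y' : M}, IsOPair p x y → IsOPair p x y' → y = x ∨ y = y' := by
    intro y y' h h'
    obtain ⟨b, hb⟩ := hM.pairing x y
    rcases (h' b).1 ((h b).2 (.inr hb)) with h1 | h1
    · exact .inl (((h1 _).1 hb.right).elim id id)
    · exact (h1 _).1 hb.right
  rcases aux h h' with h1 | h1
  · rcases aux h' h with h2 | h2
    · rw [h1, h2]
    · exact h2.symm
  · exact h1

theorem opair_unique {p p' x y : M} (h : IsOPair p x y) (h' : IsOPair p' x y) : p = p' :=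
  hM.extensionality _ _ fun z => (h z).trans (h' z).symm

theorem rel_iff_mem {f p x y : M} (h : IsOPair p x y) : Rel f x y ↔ p ∈ₛ f :=
  ⟨fun ⟨_, hp', hf⟩ => hM.opair_unique h hp' ▸ hf, fun hf => ⟨p, h, hf⟩⟩

/-- The union of a definable set-indexed family of classes contained in sets is a set. -/
theorem exists_biUnion (a : M) (R : M → M → Prop) [h : DefIn₂ R]
    (hR : ∀ x, x ∈ₛ a → ∃ b, ∀ y, R x y → y ∈ₛ b) :
    ∃ b, ∀ y, y ∈ₛ b ↔ ∃ x, x ∈ₛ a ∧ R x y := by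
  -- Made available to instance search, this certifies definability of the compound predicates built
  -- from `R` below.
  have := @h.subst
  obtain ⟨B, hB⟩ := hM.coll a (fun x b => ∀ y, R x y → y ∈ₛ b) hR
  obtain ⟨U, hU⟩ := hM.union B
  obtain ⟨b, hb⟩ := hM.sep U (fun y => ∃ x, x ∈ₛ a ∧ R x y)
  refine ⟨b, fun y => (hb y).trans ⟨And.right, fun hy => ⟨?_, hy⟩⟩⟩
  obtain ⟨x, hx, hxy⟩ := hy
  obtain ⟨c, hc, hc'⟩ := hB x hx
  exact (hU y).2 ⟨c, hc, hc' y hxy⟩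

theorem exists_image (a : M) (R : M → M → Prop) [h : DefIn₂ R]
    (hR : ∀ x, x ∈ₛ a → ∀ y y', R x y → R x y' → y = y') :
    ∃ b, ∀ y, y ∈ₛ b ↔ ∃ x, x ∈ₛ a ∧ R x y := by
  refine hM.exists_biUnion a R fun x hx => ?_
  by_cases hy : ∃ y, R x y
  · obtain ⟨y, hy⟩ := hy
    obtain ⟨b, hb⟩ := hM.exists_singleton y
    exact ⟨b, fun y' hy' => (hb _).2 (hR x hx _ _ hy' hy)⟩
  · exact ⟨a, fun y' hy' => (hy ⟨y', hy'⟩).elim⟩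

/-- A definable binary relation on a set is given by a set of ordered pairs. -/
theorem exists_rel (a : M) (R : M → M → Prop) [h : DefIn₂ R]
    (hR : ∀ x y, R x y → x ∈ₛ a ∧ y ∈ₛ a) :
    ∃ f, (∀ p, p ∈ₛ f → ∃ x y, R x y ∧ IsOPair p x y) ∧ ∀ x y, Rel f x y ↔ R x y := by
  have := @h.subst
  -- A Kuratowski pair of members of `a` lies in the double power set of `a`.
  obtain ⟨b, hb⟩ := hM.power a
  obtain ⟨c, hc⟩ := hM.power b
  obtain ⟨f, hf⟩ := hM.sep c (fun p => ∃ x y, R x y ∧ IsOPair p x y)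
  refine ⟨f, fun p hp => ((hf p).1 hp).2, fun x y => ⟨?_, fun hxy => ?_⟩⟩
  · rintro ⟨p, hp, hpf⟩
    obtain ⟨-, x', y', hR', hp'⟩ := (hf p).1 hpf
    obtain ⟨rfl, rfl⟩ := hM.opair_inj hp hp'
    exact hR'
  · obtain ⟨p, hp⟩ := hM.exists_opair x y
    refine ⟨p, hp, (hf p).2 ⟨(hc p).2 fun z hz => (hb z).2 fun w hw => ?_, x, y, hxy, hp⟩⟩
    obtain ⟨hx, hy⟩ := hR x y hxy
    rcases (hp z).1 hz with h1 | h1 <;> rcases (h1 w).1 hw with rfl | rfl <;> assumption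

theorem exists_field (f : M) : ∃ c, ∀ x y, Rel f x y → x ∈ₛ c ∧ y ∈ₛ c := by
  obtain ⟨b, hb⟩ := hM.union f
  obtain ⟨c, hc⟩ := hM.union b
  refine ⟨c, fun x y ⟨p, hp, hpf⟩ => ?_⟩
  obtain ⟨d, hd⟩ := hM.pairing x y
  have hdb : d ∈ₛ b := (hb d).2 ⟨p, hpf, (hp d).2 (.inr hd)⟩
  exact ⟨(hc x).2 ⟨d, hdb, hd.left⟩, (hc y).2 ⟨d, hdb, hd.right⟩⟩

theorem exists_dom (f : M) : ∃ d, ∀ x, x ∈ₛ d ↔ ∃ y, Rel f x y := by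
  obtain ⟨c, hc⟩ := hM.exists_field f
  obtain ⟨d, hd⟩ := hM.sep c (fun x => ∃ y, Rel f x y)
  exact ⟨d, fun x => (hd x).trans ⟨And.right, fun ⟨y, hy⟩ => ⟨(hc x y hy).1, y, hy⟩⟩⟩

theorem exists_converse (f : M) : ∃ g, ∀ x y, Rel g x y ↔ Rel f y x := by
  obtain ⟨c, hc⟩ := hM.exists_field f
  obtain ⟨g, -, hg⟩ := hM.exists_rel c (fun x y => Rel f y x) (fun x y h => (hc y x h).symm)
  exact ⟨g, hg⟩

/-- No set contains all sets (Russell). -/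
theorem exists_not_mem (a : M) : ∃ m, ¬ m ∈ₛ a := by
  obtain ⟨m, hm⟩ := hM.sep a (fun x => ¬ x ∈ₛ x)
  refine ⟨m, fun h => ?_⟩
  by_cases h' : m ∈ₛ m
  · exact ((hm m).1 h').2 h'
  · exact h' ((hm m).2 ⟨h, h'⟩)

end ModelsZFGC

end Sets

/-! ### Ordinals without foundation, and transitive closures -/

section Ordinals

variable {M : Type u} [memLang.Structure M]

/-- `x` lies in the transitive closure of `{y}`. -/
def InTC (x y : M) : Prop := ∀ t, TransSet t → y ∈ₛ t → x ∈ₛ t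

/-- `s` is a finite-path certificate for membership in the transitive closure of `{x}`: every
`v` occurring in `s` with height `k` is `x` or is a member of something of smaller height. -/
def IsPathSet (s x : M) : Prop :=
  ∀ k v, Rel s k v → v = x ∨ ∃ k' u, k' ∈ₛ k ∧ v ∈ₛ u ∧ Rel s k' u

/-- `z` is reached from `x` along a descending path certified at height `k`. -/
def Reach (x k z : M) : Prop := ∃ s, IsPathSet s x ∧ Rel s k z

variable [choiceLang.Structure M]

instance IsDef.inTC {I : Type*} {M : I → Type u} [∀ i, memLang.Structure (M i)]
    [∀ i, choiceLang.Structure (M i)] {κ α : Type*} {p : ∀ i, κ → M i}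
    {s t : ∀ i, (α → M i) → M i} [IsTm p s] [IsTm p t] :
    IsDef p (fun i v => InTC (s i v) (t i v)) :=
  subst₂ (R := fun _ => InTC) (by unfold InTC; infer_instance)

instance IsDef.isPathSet {I : Type*} {M : I → Type u} [∀ i, memLang.Structure (M i)]
    [∀ i, choiceLang.Structure (M i)] {κ α : Type*} {p : ∀ i, κ → M i}
    {s t : ∀ i, (α → M i) → M i} [IsTm p s] [IsTm p t] :
    IsDef p (fun i v => IsPathSet (s i v) (t i v)) :=
  subst₂ (R := fun _ => IsPathSet) (by unfold IsPathSet; infer_instance)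

instance IsDef.reach {I : Type*} {M : I → Type u} [∀ i, memLang.Structure (M i)]
    [∀ i, choiceLang.Structure (M i)] {κ α : Type*} {p : ∀ i, κ → M i}
    {r s t : ∀ i, (α → M i) → M i} [IsTm p r] [IsTm p s] [IsTm p t] :
    IsDef p (fun i v => Reach (r i v) (s i v) (t i v)) :=
  subst₃ (R := fun _ => Reach) (by unfold Reach; infer_instance)

namespace ModelsZFGC

variable (hM : ModelsZFGC M)
include hM

theorem ord_irrefl_of_mem {α x : M} (hα : IsOrd α) (hx : x ∈ₛ α) : ¬ x ∈ₛ x := by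
  obtain ⟨s, hs⟩ := hM.exists_singleton x
  obtain ⟨m, hm, hm'⟩ := hα.2.2 s (fun z hz => (hs z).1 hz ▸ hx) ⟨x, (hs x).2 rfl⟩
  obtain rfl := (hs m).1 hm
  exact hm' _ hm

theorem ord_irrefl {α : M} (hα : IsOrd α) : ¬ α ∈ₛ α := fun h =>
  hM.ord_irrefl_of_mem hα h h

theorem ord_no_cycle {α x y : M} (hα : IsOrd α) (hx : x ∈ₛ α) (hy : y ∈ₛ α) (hxy : x ∈ₛ y) :
    ¬ y ∈ₛ x := by
  obtain ⟨s, hs⟩ := hM.pairing x y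
  obtain ⟨m, hm, hm'⟩ := hα.2.2 s
    (fun z hz => by rcases (hs z).1 hz with rfl | rfl <;> assumption) ⟨x, hs.left⟩
  intro hyx
  rcases (hs m).1 hm with rfl | rfl
  · exact hm' _ hs.right hyx
  · exact hm' _ hs.left hxy

theorem ord_trans {α x y z : M} (hα : IsOrd α) (hx : x ∈ₛ α) (hy : y ∈ₛ α) (hz : z ∈ₛ α)
    (hxy : x ∈ₛ y) (hyz : y ∈ₛ z) : x ∈ₛ z := by
  rcases hα.2.1 x z hx hz with h | rfl | h
  · exact h
  · exact (hM.ord_no_cycle hα hx hy hxy hyz).elim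
  · obtain ⟨s, hs⟩ := hM.pairing x y
    obtain ⟨s', hs'⟩ := hM.exists_insert s z
    obtain ⟨m, hm, hm'⟩ := hα.2.2 s'
      (fun w hw => by
        rcases (hs' w).1 hw with hw | rfl
        · rcases (hs w).1 hw with rfl | rfl <;> assumption
        · assumption) ⟨z, (hs' z).2 (.inr rfl)⟩
    rcases (hs' m).1 hm with hm | rfl
    · rcases (hs m).1 hm with rfl | rfl
      · exact (hm' z ((hs' _).2 (.inr rfl)) h).elim
      · exact (hm' x ((hs' _).2 (.inl hs.left)) hxy).elim
    · exact (hm' y ((hs' _).2 (.inl hs.right)) hyz).elim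

theorem ord_of_mem {α β : M} (hα : IsOrd α) (hβ : β ∈ₛ α) : IsOrd β := by
  have hsub : Sub β α := fun z hz => hα.1 z β hz hβ
  refine ⟨fun x y hxy hy => ?_, fun x y hx hy => hα.2.1 x y (hsub x hx) (hsub y hy),
    fun s hs => hα.2.2 s fun z hz => hsub z (hs z hz)⟩
  exact hM.ord_trans hα (hα.1 x y hxy (hsub y hy)) (hsub y hy) hβ hxy hy

/-- The intersection `γ` is either all of `α` or the least element of `α` outside `γ`, and likewise
for `β`. If it were a member of both, then `γ ∈ γ`. -/
theorem ord_total {α β : M} (hα : IsOrd α) (hβ : IsOrd β) : α ∈ₛ β ∨ α = β ∨ β ∈ₛ α := by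
  obtain ⟨γ, hγ⟩ := hM.sep α (fun x => x ∈ₛ β)
  have aux : ∀ {α β : M}, IsOrd α → IsOrd β → (∀ x, x ∈ₛ γ ↔ x ∈ₛ α ∧ x ∈ₛ β) →
      γ = α ∨ γ ∈ₛ α := by
    intro α β hα hβ hγ
    by_cases hne : ∃ z, z ∈ₛ α ∧ ¬ z ∈ₛ γ
    · right
      obtain ⟨s, hs⟩ := hM.sep α (fun z => ¬ z ∈ₛ γ)
      obtain ⟨m, hm, hm'⟩ := hα.2.2 s (fun z hz => ((hs z).1 hz).1)
        (hne.imp fun z hz => (hs z).2 hz)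
      obtain ⟨hmα, hmγ⟩ := (hs m).1 hm
      have : m = γ := hM.extensionality _ _ fun z => by
        constructor
        · intro hz
          by_contra hzγ
          exact hm' z ((hs z).2 ⟨hα.1 z m hz hmα, hzγ⟩) hz
        · intro hz
          obtain ⟨hzα, hzβ⟩ := (hγ z).1 hz
          rcases hα.2.1 z m hzα hmα with h | rfl | h
          · exact h
          · exact (hmγ hz).elim
          · exact (hmγ ((hγ m).2 ⟨hmα, hβ.1 m z h hzβ⟩)).elim
      exact this ▸ hmα
    · push Not at hne
      exact .inl (hM.extensionality _ _ fun z => ⟨fun hz => ((hγ z).1 hz).1, hne z⟩)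
  rcases aux hα hβ hγ with h1 | h1
  · subst h1
    rcases aux hβ hα (fun x => (hγ x).trans and_comm) with h2 | h2
    · exact .inr (.inl h2)
    · exact .inl h2
  · rcases aux hβ hα (fun x => (hγ x).trans and_comm) with h2 | h2
    · subst h2
      exact .inr (.inr h1)
    · exact (hM.ord_irrefl_of_mem hα h1 ((hγ γ).2 ⟨h1, h2⟩)).elim

theorem exists_least_ord (P : M → Prop) [h : DefIn₁ P] (hP : ∃ α, IsOrd α ∧ P α) :
    ∃ α, IsOrd α ∧ P α ∧ ∀ β, β ∈ₛ α → ¬ P β := by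
  have := @h.subst
  obtain ⟨α, hα, hPα⟩ := hP
  obtain ⟨s, hs⟩ := hM.sep α P
  by_cases hne : ∃ z, z ∈ₛ s
  · obtain ⟨m, hm, hm'⟩ := hα.2.2 s (fun z hz => ((hs z).1 hz).1) hne
    obtain ⟨hmα, hmP⟩ := (hs m).1 hm
    exact ⟨m, hM.ord_of_mem hα hmα, hmP, fun β hβ hPβ =>
      hm' β ((hs β).2 ⟨hα.1 β m hβ hmα, hPβ⟩) hβ⟩
  · push Not at hne
    exact ⟨α, hα, hPα, fun β hβ hPβ => hne β ((hs β).2 ⟨hβ, hPβ⟩)⟩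

theorem ord_succ {α s : M} (hα : IsOrd α) (hs : ∀ z, z ∈ₛ s ↔ z ∈ₛ α ∨ z = α) : IsOrd s := by
  refine ⟨fun x y hxy hy => ?_, fun x y hx hy => ?_, fun r hr hne => ?_⟩
  · rcases (hs y).1 hy with hy | rfl
    · exact (hs x).2 (.inl (hα.1 x y hxy hy))
    · exact (hs x).2 (.inl hxy)
  · rcases (hs x).1 hx with hx | rfl <;> rcases (hs y).1 hy with hy | rfl
    · exact hα.2.1 x y hx hy
    · exact .inl hx
    · exact .inr (.inr hy)
    · exact .inr (.inl rfl)
  · obtain ⟨r', hr'⟩ := hM.sep r (fun z => z ∈ₛ α)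
    by_cases hne' : ∃ z, z ∈ₛ r'
    · obtain ⟨m, hm, hm'⟩ := hα.2.2 r' (fun z hz => ((hr' z).1 hz).2) hne'
      obtain ⟨hmr, hmα⟩ := (hr' m).1 hm
      refine ⟨m, hmr, fun z hz hzm => ?_⟩
      exact hm' z ((hr' z).2 ⟨hz, hα.1 z m hzm hmα⟩) hzm
    · push Not at hne'
      have hr'' : ∀ z, z ∈ₛ r → z = α := fun z hz =>
        ((hs z).1 (hr z hz)).resolve_left fun h => hne' z ((hr' z).2 ⟨hz, h⟩)
      obtain ⟨z, hz⟩ := hne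
      refine ⟨z, hz, fun w hw => ?_⟩
      rw [hr'' z hz, hr'' w hw]
      exact hM.ord_irrefl hα

theorem reach_self (x k : M) : Reach x k x := by
  obtain ⟨a, ha⟩ := hM.pairing k x
  obtain ⟨s, -, hs⟩ := hM.exists_rel a (fun k' v => k' = k ∧ v = x)
    (fun k' v ⟨h, h'⟩ => ⟨h ▸ ha.left, h' ▸ ha.right⟩)
  exact ⟨s, fun k' v h => .inl ((hs k' v).1 h).2, (hs k x).2 ⟨rfl, rfl⟩⟩

theorem reach_succ {x k k' z y : M} (h : Reach x k z) (hk : k ∈ₛ k') (hy : y ∈ₛ z) :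
    Reach x k' y := by
  obtain ⟨s, hs, hkz⟩ := h
  obtain ⟨c, hc⟩ := hM.exists_field s
  obtain ⟨a, ha⟩ := hM.pairing k' y
  obtain ⟨b, hb⟩ := hM.exists_union₂ c a
  obtain ⟨r, -, hr⟩ := hM.exists_rel b (fun l v => Rel s l v ∨ (l = k' ∧ v = y)) (by
    rintro l v (h | ⟨rfl, rfl⟩)
    · exact ⟨(hb _).2 (.inl (hc l v h).1), (hb _).2 (.inl (hc l v h).2)⟩
    · exact ⟨(hb _).2 (.inr ha.left), (hb _).2 (.inr ha.right)⟩)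
  refine ⟨r, fun l v hlv => ?_, (hr _ _).2 (.inr ⟨rfl, rfl⟩)⟩
  rcases (hr l v).1 hlv with h | ⟨rfl, rfl⟩
  · rcases hs l v h with h | ⟨l', u, h1, h2, h3⟩
    · exact .inl h
    · exact .inr ⟨l', u, h1, h2, (hr _ _).2 (.inl h3)⟩
  · exact .inr ⟨k, z, hk, hy, (hr _ _).2 (.inl hkz)⟩

/-- In a least counterexample, everything reached is `x` or a member of something reached at a
smaller height, and those sets are already bounded. -/
theorem reach_small (x : M) {k : M} (hk : IsOrd k) : ∃ b, ∀ z, Reach x k z → z ∈ₛ b := by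
  by_contra hcon
  obtain ⟨α, hα, hcon, hmin⟩ := hM.exists_least_ord (fun k => ¬ ∃ b, ∀ z, Reach x k z → z ∈ₛ b)
    ⟨k, hk, hcon⟩
  simp only [not_not] at hmin
  obtain ⟨U, hU⟩ := hM.exists_biUnion α (Reach x) hmin
  obtain ⟨U', hU'⟩ := hM.union U
  obtain ⟨b, hb⟩ := hM.exists_insert U' x
  refine hcon ⟨b, fun z ⟨s, hs, hz⟩ => (hb z).2 ?_⟩
  rcases hs _ _ hz with h | ⟨l, u, h1, h2, h3⟩
  · exact .inr h
  · exact .inl ((hU' z).2 ⟨u, (hU u).2 ⟨l, h1, s, hs, h3⟩, h2⟩)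

/-- Every set is a member of a transitive set. -/
theorem exists_transSet (x : M) : ∃ t, TransSet t ∧ x ∈ₛ t := by
  obtain ⟨w, ⟨o, ho, how⟩, hw⟩ := hM.infinity
  -- The ordinals of an inductive set are closed under successor, which suffices for the heights;
  -- they need not form exactly `ω`.
  obtain ⟨w', hw'⟩ := hM.sep w IsOrd
  obtain ⟨t, ht⟩ := hM.exists_biUnion w' (Reach x) fun k hk => hM.reach_small x ((hw' k).1 hk).2
  refine ⟨t, fun y z hyz hz => ?_, (ht x).2 ⟨o, (hw' o).2 ⟨how, ?_⟩, hM.reach_self x o⟩⟩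
  · obtain ⟨k, hk, hkz⟩ := (ht z).1 hz
    obtain ⟨hkw, hko⟩ := (hw' k).1 hk
    obtain ⟨k', hk', hkw'⟩ := hw k hkw
    exact (ht y).2 ⟨k', (hw' k').2 ⟨hkw', hM.ord_succ hko hk'⟩,
      hM.reach_succ hkz ((hk' k).2 (.inr rfl)) hyz⟩
  · refine ⟨fun _ _ _ h => (ho _ h).elim, fun _ _ h => (ho _ h).elim, fun s hs ⟨z, hz⟩ => ?_⟩
    exact (ho _ (hs z hz)).elim

/-- Transitive closures exist. -/
theorem exists_tc (y : M) : ∃ t, ∀ x, x ∈ₛ t ↔ InTC x y := by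
  obtain ⟨t, ht, hy⟩ := hM.exists_transSet y
  obtain ⟨c, hc⟩ := hM.sep t (fun x => InTC x y)
  exact ⟨c, fun x => (hc x).trans ⟨And.right, fun h => ⟨h t ht hy, h⟩⟩⟩

end ModelsZFGC

omit [choiceLang.Structure M] in
theorem InTC.refl (x : M) : InTC x x := fun _ _ h => h

omit [choiceLang.Structure M] in
theorem InTC.of_mem {x y z : M} (h : InTC y z) (hx : x ∈ₛ y) : InTC x z :=
  fun t ht hz => ht x y hx (h t ht hz)

end Ordinals

/-! ### The global well-order induced by `C` -/

section GlobalOrder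

variable {M : Type u} [memLang.Structure M] [choiceLang.Structure M]

/-- The global well-order given by `C`: the ordinal coding `x` is less than that coding `y`. -/
def Before (x y : M) : Prop :=
  ∃ α β, IsOrd β ∧ choiceFn α = x ∧ choiceFn β = y ∧ α ∈ₛ β

instance IsDef.before {I : Type*} {M : I → Type u} [∀ i, memLang.Structure (M i)]
    [∀ i, choiceLang.Structure (M i)] {κ α : Type*} {p : ∀ i, κ → M i}
    {s t : ∀ i, (α → M i) → M i} [IsTm p s] [IsTm p t] :
    IsDef p (fun i v => Before (s i v) (t i v)) :=
  subst₂ (R := fun _ => Before) (by unfold Before; infer_instance)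

namespace ModelsZFGC

variable (hM : ModelsZFGC M)
include hM

theorem choiceFn_inj {α β : M} (hα : IsOrd α) (hβ : IsOrd β) (h : choiceFn α = choiceFn β) :
    α = β :=
  (hM.globalChoice (choiceFn β)).unique ⟨hα, h⟩ ⟨hβ, rfl⟩

theorem before_iff {α β : M} (hα : IsOrd α) (hβ : IsOrd β) :
    Before (choiceFn α) (choiceFn β) ↔ α ∈ₛ β := by
  refine ⟨fun ⟨α', β', hβ', h1, h2, h⟩ => ?_, fun h => ⟨α, β, hβ, rfl, rfl, h⟩⟩
  obtain rfl := hM.choiceFn_inj hβ' hβ h2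
  obtain rfl := hM.choiceFn_inj (hM.ord_of_mem hβ' h) hα h1
  exact h

theorem before_total (x y : M) : Before x y ∨ x = y ∨ Before y x := by
  obtain ⟨α, ⟨hα, rfl⟩, -⟩ := hM.globalChoice x
  obtain ⟨β, ⟨hβ, rfl⟩, -⟩ := hM.globalChoice y
  rw [hM.before_iff hα hβ, hM.before_iff hβ hα]
  exact (hM.ord_total hα hβ).imp_right (.imp_left (congrArg _))

theorem before_trans {x y z : M} (hxy : Before x y) (hyz : Before y z) : Before x z := by
  obtain ⟨α, ⟨hα, rfl⟩, -⟩ := hM.globalChoice x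
  obtain ⟨β, ⟨hβ, rfl⟩, -⟩ := hM.globalChoice y
  obtain ⟨γ, ⟨hγ, rfl⟩, -⟩ := hM.globalChoice z
  rw [hM.before_iff hα hβ] at hxy
  rw [hM.before_iff hβ hγ] at hyz
  rw [hM.before_iff hα hγ]
  exact hγ.1 _ _ hxy hyz

theorem before_irrefl (x : M) : ¬ Before x x := by
  obtain ⟨α, ⟨hα, rfl⟩, -⟩ := hM.globalChoice x
  rw [hM.before_iff hα hα]
  exact hM.ord_irrefl hα

/-- The order is set-like because an initial segment is the image of an ordinal under `C`. -/
theorem exists_initial (x : M) : ∃ s, ∀ y, y ∈ₛ s ↔ Before y x := by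
  obtain ⟨α, ⟨hα, rfl⟩, -⟩ := hM.globalChoice x
  obtain ⟨s, hs⟩ := hM.exists_image α (fun β y => choiceFn β = y)
    (fun β _ y y' h h' => h.symm.trans h')
  refine ⟨s, fun y => (hs y).trans ?_⟩
  constructor
  · rintro ⟨β, hβ, rfl⟩
    exact (hM.before_iff (hM.ord_of_mem hα hβ) hα).2 hβ
  · intro h
    obtain ⟨β, ⟨hβ, rfl⟩, -⟩ := hM.globalChoice y
    exact ⟨β, (hM.before_iff hβ hα).1 h, rfl⟩

theorem exists_least (P : M → Prop) [h : DefIn₁ P] (hP : ∃ x, P x) :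
    ∃ x, P x ∧ ∀ y, Before y x → ¬ P y := by
  have := @h.subst
  obtain ⟨x, hx⟩ := hP
  obtain ⟨α, ⟨hα, rfl⟩, -⟩ := hM.globalChoice x
  obtain ⟨β, hβ, ⟨x, rfl, hx'⟩, hmin⟩ := hM.exists_least_ord (fun β => ∃ x, choiceFn β = x ∧ P x)
    ⟨α, hα, _, rfl, hx⟩
  refine ⟨_, hx', fun y hy hPy => ?_⟩
  obtain ⟨γ, ⟨hγ, rfl⟩, -⟩ := hM.globalChoice y
  exact hmin γ ((hM.before_iff hγ hβ).1 hy) ⟨_, rfl, hPy⟩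

theorem before_induction (P : M → Prop) [h : DefIn₁ P]
    (ih : ∀ x, (∀ y, Before y x → P y) → P x) (x : M) : P x := by
  have := @h.subst
  by_contra hx
  obtain ⟨x, hx, hmin⟩ := hM.exists_least (fun x => ¬ P x) ⟨x, hx⟩
  exact hx (ih x fun y hy => not_not.1 (hmin y hy))

end ModelsZFGC

end GlobalOrder

/-! ### Isomorphisms of transitive sets and back-and-forth -/

section Embeddings

variable {M : Type u} [memLang.Structure M]

/-- `R` is an `∈`-isomorphism between two transitive classes. -/
def IsEmbRel (R : M → M → Prop) : Prop :=
  (∀ x y x' y', R x y → R x' y' → (x = x' ↔ y = y') ∧ (x ∈ₛ x' ↔ y ∈ₛ y')) ∧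
  (∀ x y z, R x y → z ∈ₛ x → ∃ w, R z w) ∧
  (∀ x y w, R x y → w ∈ₛ y → ∃ z, R z w)

/-- The set `f`, as a binary relation, is an `∈`-isomorphism between two transitive sets. -/
def IsEmb (f : M) : Prop := IsEmbRel (Rel f)

/-- `y` is a member of `s` outside the domain of `f`. -/
def NewIn (f s y : M) : Prop := y ∈ₛ s ∧ ¬ ∃ w, Rel f y w

/-- `c` codes the member `x` of `s`: by its value under `f` if there is one, and by the pair
`⟨x, m⟩` otherwise. -/
def Code (f s m x c : M) : Prop := Rel f x c ∨ NewIn f s x ∧ IsOPair c x m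

/-- Membership on `t`, together with the relation copied from `s` below the new codes. -/
def CodeRel (f s m t c d : M) : Prop :=
  c ∈ₛ t ∧ d ∈ₛ t ∧ c ∈ₛ d ∨ ∃ x y, NewIn f s y ∧ IsOPair d y m ∧ Code f s m x c ∧ x ∈ₛ y

variable [choiceLang.Structure M]

instance IsDef.isEmb {I : Type*} {M : I → Type u} [∀ i, memLang.Structure (M i)]
    [∀ i, choiceLang.Structure (M i)] {κ α : Type*} {p : ∀ i, κ → M i}
    {s : ∀ i, (α → M i) → M i} [IsTm p s] :
    IsDef p (fun i v => IsEmb (s i v)) :=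
  subst₁ (R := fun _ => IsEmb) (by unfold IsEmb IsEmbRel; infer_instance)

instance IsDef.newIn {I : Type*} {M : I → Type u} [∀ i, memLang.Structure (M i)]
    [∀ i, choiceLang.Structure (M i)] {κ α : Type*} {p : ∀ i, κ → M i}
    {r s t : ∀ i, (α → M i) → M i} [IsTm p r] [IsTm p s] [IsTm p t] :
    IsDef p (fun i v => NewIn (r i v) (s i v) (t i v)) :=
  subst₃ (R := fun _ => NewIn) (by unfold NewIn; infer_instance)

instance DefIn.code (f s m : M) {α : Type} {a b : (α → M) → M}
    [IsTm (I := Unit) (M := fun _ => M) (fun _ m => m) (fun _ v => a v)]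
    [IsTm (I := Unit) (M := fun _ => M) (fun _ m => m) (fun _ v => b v)] :
    DefIn M (fun v => Code f s m (a v) (b v)) :=
  DefIn₂.subst (by unfold Code; infer_instance)

instance DefIn.codeRel (f s m t : M) {α : Type} {a b : (α → M) → M}
    [IsTm (I := Unit) (M := fun _ => M) (fun _ m => m) (fun _ v => a v)]
    [IsTm (I := Unit) (M := fun _ => M) (fun _ m => m) (fun _ v => b v)] :
    DefIn M (fun v => CodeRel f s m t (a v) (b v)) :=
  DefIn₂.subst (by unfold CodeRel; infer_instance)

omit [choiceLang.Structure M] in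
theorem IsEmbRel.flip {R : M → M → Prop} (h : IsEmbRel R) : IsEmbRel (flip R) :=
  ⟨fun x y x' y' h1 h2 => ⟨(h.1 y x y' x' h1 h2).1.symm, (h.1 y x y' x' h1 h2).2.symm⟩,
    fun x y z h1 h2 => h.2.2 y x z h1 h2, fun x y w h1 h2 => h.2.1 y x w h1 h2⟩

namespace ModelsZFGC

variable (hM : ModelsZFGC M)
include hM

/-- A transitive set containing the pair would contain `m`. Pairs with second entry `m` thus supply
points outside `t`. -/
theorem opair_notin {t m c x : M} (ht : TransSet t) (hm : ¬ m ∈ₛ t) (hc : IsOPair c x m) :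
    ¬ c ∈ₛ t := by
  intro h
  obtain ⟨b, hb⟩ := hM.pairing x m
  exact hm (ht m b hb.right (ht b c ((hc b).2 (.inr hb)) h))

section Code

variable {f s m t : M} (hf : IsEmb f) (hs : TransSet s) (ht : TransSet t) (hm : ¬ m ∈ₛ t)
  (hfs : ∀ x y, Rel f x y → x ∈ₛ s) (hft : ∀ x y, Rel f x y → y ∈ₛ t)

theorem exists_code {x : M} (hx : x ∈ₛ s) : ∃ c, Code f s m x c := by
  by_cases h : ∃ w, Rel f x w
  · exact h.imp fun w hw => .inl hw
  · obtain ⟨c, hc⟩ := hM.exists_opair x m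
    exact ⟨c, .inr ⟨⟨hx, h⟩, hc⟩⟩

include hf ht hm hft in
theorem code_eq_iff {x x' c c' : M} (h : Code f s m x c) (h' : Code f s m x' c') :
    x = x' ↔ c = c' := by
  rcases h with h | ⟨h, hc⟩ <;> rcases h' with h' | ⟨h', hc'⟩
  · exact (hf.1 _ _ _ _ h h').1
  · refine ⟨?_, ?_⟩
    · rintro rfl; exact (h'.2 ⟨_, h⟩).elim
    · rintro rfl; exact (hM.opair_notin ht hm hc' (hft _ _ h)).elim
  · refine ⟨?_, ?_⟩
    · rintro rfl; exact (h.2 ⟨_, h'⟩).elim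
    · rintro rfl; exact (hM.opair_notin ht hm hc (hft _ _ h')).elim
  · refine ⟨?_, ?_⟩
    · rintro rfl; exact hM.opair_unique hc hc'
    · rintro rfl; exact (hM.opair_inj hc hc').1

include ht hm in
theorem codeRel_iff_of_mem {c d : M} (hd : d ∈ₛ t) : CodeRel f s m t c d ↔ c ∈ₛ d := by
  refine ⟨?_, fun h => .inl ⟨ht c d h hd, hd, h⟩⟩
  rintro (⟨-, -, h⟩ | ⟨x, y, -, h, -⟩)
  · exact h
  · exact (hM.opair_notin ht hm h hd).elim

-- Coding transports membership exactly: below old values because domain and range of `f` are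
-- transitive, below new codes by construction.
include hf ht hm hft in
theorem codeRel_iff_of_code {c y d : M} (hd : Code f s m y d) :
    CodeRel f s m t c d ↔ ∃ x, Code f s m x c ∧ x ∈ₛ y := by
  rcases hd with hd | ⟨hy, hd⟩
  · rw [hM.codeRel_iff_of_mem ht hm (hft _ _ hd)]
    constructor
    · intro h
      obtain ⟨x, hx⟩ := hf.2.2 _ _ _ hd h
      exact ⟨x, .inl hx, (hf.1 _ _ _ _ hx hd).2.2 h⟩
    · rintro ⟨x, hx | ⟨hx, -⟩, hxy⟩
      · exact (hf.1 _ _ _ _ hx hd).2.1 hxy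
      · exact (hx.2 (hf.2.1 _ _ _ hd hxy)).elim
  · constructor
    · rintro (⟨-, h, -⟩ | ⟨x, y', -, h, hx, hxy⟩)
      · exact (hM.opair_notin ht hm hd h).elim
      · obtain rfl := (hM.opair_inj h hd).1
        exact ⟨x, hx, hxy⟩
    · rintro ⟨x, hx, hxy⟩
      exact .inr ⟨x, y, hy, hd, hx, hxy⟩

include hfs in
omit [choiceLang.Structure M] hM in
theorem _root_.BoffaTheory.Code.mem {x c : M} (h : Code f s m x c) : x ∈ₛ s :=
  h.elim (hfs _ _) fun h => h.1.1

include hf hs ht hm hfs hft in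
theorem code_ext {y y' d d' : M} (h : Code f s m y d) (h' : Code f s m y' d')
    (hdd' : ∀ c, CodeRel f s m t c d ↔ CodeRel f s m t c d') : y = y' := by
  have aux : ∀ {y y' d d' : M}, Code f s m y d → Code f s m y' d' →
      (∀ c, CodeRel f s m t c d ↔ CodeRel f s m t c d') → ∀ x, x ∈ₛ y → x ∈ₛ y' := by
    intro y y' d d' h h' hdd' x hx
    obtain ⟨c, hc⟩ := hM.exists_code (f := f) (m := m) (hs x y hx (h.mem hfs))
    obtain ⟨x', hx', hxy'⟩ := (hM.codeRel_iff_of_code hf ht hm hft h').1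
      ((hdd' c).1 ((hM.codeRel_iff_of_code hf ht hm hft h).2 ⟨x, hc, hx⟩))
    rwa [(hM.code_eq_iff hf ht hm hft hc hx').2 rfl]
  exact hM.extensionality _ _ fun x => ⟨aux h h' hdd' x, aux h' h (fun c => (hdd' c).symm) x⟩

end Code

/-- An isomorphism `f` between transitive sets extends to any larger transitive domain `s`, with
new values outside a given transitive set `t`, if no member of `t` is a new subset of the range. -/
theorem exists_extension (hB : BAFA M) {f s t : M} (hf : IsEmb f) (hs : TransSet s)
    (ht : TransSet t) (hfs : ∀ x y, Rel f x y → x ∈ₛ s) (hft : ∀ x y, Rel f x y → y ∈ₛ t)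
    (hnew : ∀ u, u ∈ₛ t → (∀ z, z ∈ₛ u → ∃ x, Rel f x z) → ∃ x, Rel f x u) :
    ∃ g, IsEmb g ∧ (∀ x y, Rel f x y → Rel g x y) ∧ (∀ x, (∃ y, Rel g x y) ↔ x ∈ₛ s) ∧
      ∀ x y, Rel g x y → y ∈ₛ t → ∃ x', Rel f x' y := by
  obtain ⟨m, hm⟩ := hM.exists_not_mem t
  obtain ⟨N, hN⟩ := hM.exists_image s (fun x n => NewIn f s x ∧ IsOPair n x m)
    (fun x _ n n' h h' => hM.opair_unique h.2 h'.2)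
  obtain ⟨a, ha⟩ := hM.exists_union₂ t N
  have hca : ∀ {x c}, Code f s m x c → c ∈ₛ a := by
    rintro x c (h | h)
    · exact (ha c).2 (.inl (hft _ _ h))
    · exact (ha c).2 (.inr ((hN c).2 ⟨x, h.1.1, h⟩))
  have hac : ∀ {c}, c ∈ₛ a → c ∈ₛ t ∨ ∃ x, NewIn f s x ∧ IsOPair c x m := by
    intro c hc
    refine ((ha c).1 hc).imp id fun h => ?_
    obtain ⟨x, -, h⟩ := (hN c).1 h
    exact ⟨x, h⟩
  obtain ⟨e, he, hre⟩ := hM.exists_rel a (CodeRel f s m t) (by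
    rintro c d (⟨h1, h2, -⟩ | ⟨x, y, h1, h2, h3, -⟩)
    · exact ⟨(ha c).2 (.inl h1), (ha d).2 (.inl h2)⟩
    · exact ⟨hca h3, hca (.inr ⟨h1, h2⟩)⟩)
  have hra : ∀ {c d}, CodeRel f s m t c d → c ∈ₛ a ∧ d ∈ₛ a := by
    rintro c d (⟨h1, h2, -⟩ | ⟨x, y, h1, h2, h3, -⟩)
    · exact ⟨(ha c).2 (.inl h1), (ha d).2 (.inl h2)⟩
    · exact ⟨hca h3, hca (.inr ⟨h1, h2⟩)⟩
  have hsame : ∀ {c d}, (∀ z, z ∈ₛ a → (Rel e z c ↔ Rel e z d)) →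
      ∀ z, CodeRel f s m t z c ↔ CodeRel f s m t z d := by
    intro c d h z
    by_cases hz : z ∈ₛ a
    · rw [← hre, ← hre, h z hz]
    · exact ⟨fun h => (hz (hra h).1).elim, fun h => (hz (hra h).1).elim⟩
  -- a member of `t` and a new code never have the same predecessors
  have hmix : ∀ {c d y}, c ∈ₛ t → NewIn f s y → IsOPair d y m →
      (∀ z, CodeRel f s m t z c ↔ CodeRel f s m t z d) → False := by
    intro c d y hc hy hd h
    have hdc : Code f s m y d := .inr ⟨hy, hd⟩
    -- Every member of `c` is the code of something and lies in `t`, hence is a value of `f`. So `c`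
    -- is a subset of the range, and `hnew` makes it a value too.
    obtain ⟨x, hx⟩ := hnew c hc fun z hz => by
      obtain ⟨x, hx | ⟨-, hx⟩, -⟩ := (hM.codeRel_iff_of_code hf ht hm hft hdc).1
        ((h z).1 ((hM.codeRel_iff_of_mem ht hm hc).2 hz))
      · exact ⟨x, hx⟩
      · exact (hM.opair_notin ht hm hx (ht z c hz hc)).elim
    obtain rfl := hM.code_ext hf hs ht hm hfs hft (.inl hx) hdc h
    exact hy.2 ⟨c, hx⟩
  have hext : ExtRel a e := by
    refine ⟨fun p hp => ?_, fun c d hc hd h => ?_⟩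
    · obtain ⟨c, d, h, hp⟩ := he p hp
      exact ⟨c, d, (hra h).1, (hra h).2, hp⟩
    · replace h := hsame h
      rcases hac hc with hc | ⟨x, hx, hc⟩ <;> rcases hac hd with hd | ⟨y, hy, hd⟩
      · exact hM.extensionality _ _ fun z => by
          rw [← hM.codeRel_iff_of_mem (f := f) (s := s) ht hm hc, h,
            hM.codeRel_iff_of_mem ht hm hd]
      · exact (hmix hc hy hd h).elim
      · exact (hmix hd hx hc fun z => (h z).symm).elim
      · obtain rfl := hM.code_ext hf hs ht hm hfs hft (.inr ⟨hx, hc⟩) (.inr ⟨hy, hd⟩) h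
        exact hM.opair_unique hc hd
  have hend : EndExtends a e t := by
    refine ⟨fun z hz => (ha z).2 (.inl hz), fun x y => ?_⟩
    rw [hre]
    constructor
    · rintro ⟨hx, hy, h⟩
      exact ⟨.inl ⟨hx, hy, h⟩, (ha x).2 (.inl hx), hy⟩
    · rintro ⟨h, -, hy⟩
      have := (hM.codeRel_iff_of_mem ht hm hy).1 h
      exact ⟨ht x y this hy, hy, this⟩
  -- Collapsing over `t` fixes the old values, so coding followed by `h` extends `f`.
  obtain ⟨r, h, hr, ⟨hsub, htot, hinj, hiso⟩, hid⟩ := hB t a e ht hext hend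
  have hrng : ∀ {c y}, Rel h c y → c ∈ₛ a ∧ y ∈ₛ r := by
    rintro c y ⟨p, hp, hph⟩
    obtain ⟨c', y', hc', hy', hp'⟩ := hsub p hph
    obtain ⟨rfl, rfl⟩ := hM.opair_inj hp hp'
    exact ⟨hc', hy'⟩
  obtain ⟨b, hb⟩ := hM.exists_union₂ s r
  obtain ⟨g, -, hg⟩ := hM.exists_rel b (fun x y => ∃ c, Code f s m x c ∧ Rel h c y) (by
    rintro x y ⟨c, hc, hcy⟩
    exact ⟨(hb x).2 (.inl (hc.mem hfs)), (hb y).2 (.inr (hrng hcy).2)⟩)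
  have hval : ∀ {x}, x ∈ₛ s → ∃ y, Rel g x y := by
    intro x hx
    obtain ⟨c, hc⟩ := hM.exists_code (f := f) (m := m) hx
    obtain ⟨y, hy, -⟩ := htot c (hca hc)
    exact ⟨y, (hg x y).2 ⟨c, hc, hy⟩⟩
  have hdom : ∀ {x y}, Rel g x y → x ∈ₛ s := by
    intro x y hxy
    obtain ⟨c, hc, -⟩ := (hg x y).1 hxy
    exact hc.mem hfs
  refine ⟨g, ⟨fun x y x' y' h1 h2 => ?_, fun x y z h1 hz => hval (hs z x hz (hdom h1)),
    fun x y w h1 hw => ?_⟩, fun x y hxy => (hg x y).2 ⟨y, .inl hxy, hid y (hft x y hxy)⟩,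
    fun x => ⟨fun ⟨y, hy⟩ => hdom hy, hval⟩, fun x y hxy hy => ?_⟩
  · obtain ⟨c, hc, hcy⟩ := (hg _ _).1 h1
    obtain ⟨c', hc', hcy'⟩ := (hg _ _).1 h2
    constructor
    · rw [hM.code_eq_iff hf ht hm hft hc hc']
      constructor
      · rintro rfl
        exact (htot c (hca hc)).unique hcy hcy'
      · rintro rfl
        exact (hinj y (hrng hcy).2).unique hcy hcy'
    · rw [← hiso _ _ _ _ hcy hcy', hre, hM.codeRel_iff_of_code hf ht hm hft hc']
      constructor
      · intro hx
        exact ⟨x, hc, hx⟩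
      · rintro ⟨z, hz, hzx⟩
        rwa [(hM.code_eq_iff hf ht hm hft hc hz).2 rfl]
  · obtain ⟨c, hc, hcy⟩ := (hg _ _).1 h1
    obtain ⟨d, hd, -⟩ := hinj w (hr w y hw (hrng hcy).2)
    have hdc := (hiso _ _ _ _ hd hcy).2 hw
    rw [hre, hM.codeRel_iff_of_code hf ht hm hft hc] at hdc
    obtain ⟨z, hz, -⟩ := hdc
    exact ⟨z, (hg z w).2 ⟨d, hz, hd⟩⟩
  · obtain ⟨c, hc, hcy⟩ := (hg _ _).1 hxy
    -- As `h` is injective and fixes `y`, the code of `x` is `y` itself; lying in `t`, it is not a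
    -- new pair.
    obtain rfl := (hinj y (hrng hcy).2).unique hcy (hid y hy)
    rcases hc with hc | ⟨-, hc⟩
    · exact ⟨x, hc⟩
    · exact (hM.opair_notin ht hm hc hy).elim

/-- BAFA over the empty set collapses a single point related to itself. -/
theorem exists_quine (hB : BAFA M) : ∃ q : M, ∀ z, z ∈ₛ q ↔ z = q := by
  obtain ⟨o, ho⟩ := hM.exists_empty
  obtain ⟨a, ha⟩ := hM.exists_singleton o
  obtain ⟨e, he, hre⟩ := hM.exists_rel a (fun x y => x = o ∧ y = o)
    (fun x y h => ⟨(ha x).2 h.1, (ha y).2 h.2⟩)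
  obtain ⟨t, f, ht, ⟨hsub, htot, hinj, hiso⟩, -⟩ := hB o a e (fun _ _ _ h => (ho _ h).elim)
    ⟨fun p hp => by
      obtain ⟨x, y, h, hp⟩ := he p hp
      exact ⟨x, y, (ha x).2 h.1, (ha y).2 h.2, hp⟩,
      fun x y hx hy _ => ((ha x).1 hx).trans ((ha y).1 hy).symm⟩
    ⟨fun _ h => (ho _ h).elim, fun x y => ⟨fun h => (ho _ h.1).elim, fun h => (ho _ h.2.2).elim⟩⟩
  have hf : ∀ {x y}, Rel f x y → x = o ∧ y ∈ₛ t := by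
    rintro x y ⟨p, hp, hpf⟩
    obtain ⟨x', y', hx', hy', hp'⟩ := hsub p hpf
    obtain ⟨rfl, rfl⟩ := hM.opair_inj hp hp'
    exact ⟨(ha _).1 hx', hy'⟩
  obtain ⟨q, hq, hq'⟩ := htot o ((ha o).2 rfl)
  refine ⟨q, fun z => ⟨fun hz => ?_, ?_⟩⟩
  · obtain ⟨x, hx, -⟩ := hinj z (ht z q hz (hf hq).2)
    obtain rfl := (hf hx).1
    exact hq' z hx
  · rintro rfl
    exact (hiso _ _ _ _ hq hq).1 ((hre _ _).2 ⟨rfl, rfl⟩)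

/-- Isomorphisms between transitive sets have the forth property. -/
theorem exists_forth (hB : BAFA M) {f : M} (hf : IsEmb f) (x : M) :
    ∃ g, IsEmb g ∧ (∀ x y, Rel f x y → Rel g x y) ∧ ∃ y, Rel g x y := by
  obtain ⟨d, hd⟩ := hM.exists_dom f
  obtain ⟨f', hf'⟩ := hM.exists_converse f
  obtain ⟨r, hr⟩ := hM.exists_dom f'
  obtain ⟨c, hc, hxc⟩ := hM.exists_transSet x
  obtain ⟨s, hs⟩ := hM.exists_union₂ d c
  simp only [hf'] at hr
  obtain ⟨g, hg, hfg, hgs, -⟩ := hM.exists_extension hB (s := s) (t := r) hf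
    (fun z y hz hy => by
      rw [hs, hd] at hy ⊢
      rcases hy with ⟨w, hw⟩ | hy
      · exact .inl (hf.2.1 y w z hw hz)
      · exact .inr (hc z y hz hy))
    (fun w y hw hy => by
      rw [hr] at hy ⊢
      obtain ⟨z, hz⟩ := hy
      exact hf.2.2 z y w hz hw)
    (fun x y h => (hs x).2 (.inl ((hd x).2 ⟨y, h⟩))) (fun x y h => (hr y).2 ⟨x, h⟩)
    -- With `t` equal to the range, there is no further point to confuse with a new one.
    (fun u hu _ => (hr u).1 hu)
  exact ⟨g, hg, hfg, (hgs x).2 ((hs x).2 (.inr hxc))⟩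

theorem exists_back (hB : BAFA M) {f : M} (hf : IsEmb f) (y : M) :
    ∃ g, IsEmb g ∧ (∀ x y, Rel f x y → Rel g x y) ∧ ∃ x, Rel g x y := by
  have hconv : ∀ {f f' : M}, IsEmb f → (∀ x y, Rel f' x y ↔ Rel f y x) → IsEmb f' := by
    intro f f' hf h
    have : Rel f' = flip (Rel f) := funext fun x => funext fun y => propext (h x y)
    rw [IsEmb, this]
    exact IsEmbRel.flip hf
  obtain ⟨f', hf'⟩ := hM.exists_converse f
  obtain ⟨g, hg, hfg, x, hx⟩ := hM.exists_forth hB (hconv hf hf') y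
  obtain ⟨g', hg'⟩ := hM.exists_converse g
  exact ⟨g', hconv hg hg', fun x y h => (hg' x y).2 (hfg y x ((hf' y x).2 h)),
    x, (hg' x y).2 hx⟩

/-- Isomorphisms between transitive sets preserve all formulas (Ehrenfeucht–Fraïssé). -/
theorem realize_iff_of_isEmb (hB : BAFA M) {α : Type*} {n : ℕ}
    (φ : memLang.BoundedFormula α n) {f : M} (hf : IsEmb f) {v v' : α → M} {xs xs' : Fin n → M}
    (hv : ∀ i, Rel f (v i) (v' i)) (hxs : ∀ i, Rel f (xs i) (xs' i)) :
    φ.Realize v xs ↔ φ.Realize v' xs' := by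
  have htm : ∀ {f : M} {n} {xs xs' : Fin n → M}, (∀ i, Rel f (v i) (v' i)) →
      (∀ i, Rel f (xs i) (xs' i)) → ∀ τ : memLang.Term (α ⊕ Fin n),
      Rel f (τ.realize (Sum.elim v xs)) (τ.realize (Sum.elim v' xs')) := by
    intro f n xs xs' hv hxs τ
    cases τ with
    | var k => exact k.casesOn hv hxs
    | func g _ => exact nomatch g
  -- The isomorphism must vary, since each quantifier replaces it by an extension.
  induction φ generalizing f with
  | falsum => rfl
  | equal t₁ t₂ => exact (hf.1 _ _ _ _ (htm hv hxs t₁) (htm hv hxs t₂)).1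
  | rel R ts =>
    cases R
    have hpair : ∀ w : Fin 2 → M, ![w 0, w 1] = w := fun w => by
      funext i; fin_cases i <;> rfl
    have := (hf.1 _ _ _ _ (htm hv hxs (ts 0)) (htm hv hxs (ts 1))).2
    rw [Mem, Mem, hpair fun i => (ts i).realize (Sum.elim v xs),
      hpair fun i => (ts i).realize (Sum.elim v' xs')] at this
    exact this
  | imp φ ψ ih₁ ih₂ => exact imp_congr (ih₁ hf hv hxs) (ih₂ hf hv hxs)
  | all φ ih =>
    have hsnoc : ∀ {g x y}, (∀ x y, Rel f x y → Rel g x y) → Rel g x y →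
        ∀ i, Rel g ((Fin.snoc xs x : Fin _ → M) i) ((Fin.snoc xs' y : Fin _ → M) i) := by
      intro g x y hfg hxy i
      refine Fin.lastCases ?_ (fun i => ?_) i
      · simpa using hxy
      · simpa using hfg _ _ (hxs i)
    constructor
    · intro h y
      obtain ⟨g, hg, hfg, x, hx⟩ := hM.exists_back hB hf y
      exact (ih hg (fun i => hfg _ _ (hv i)) (hsnoc hfg hx)).1 (h x)
    · intro h x
      obtain ⟨g, hg, hfg, y, hy⟩ := hM.exists_forth hB hf x
      exact (ih hg (fun i => hfg _ _ (hv i)) (hsnoc hfg hy)).2 (h y)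

end ModelsZFGC

end Embeddings

/-! ### Recursive construction of the embedding along the global order -/

section Construction

variable {M : Type u} [memLang.Structure M] [choiceLang.Structure M]

/-- `q` is the first set in the global well-order that is its own singleton. -/
def LeastQuine (q : M) : Prop :=
  (∀ z, z ∈ₛ q ↔ z = q) ∧ ∀ q', Before q' q → ¬ ∀ z, z ∈ₛ q' ↔ z = q'

/-- `u` lies in the transitive closure of the sets preceding `x`. -/
def Below (x u : M) : Prop := ∃ w, Before w x ∧ InTC u w

/-- `u` lies in the transitive closure of `x` and the sets preceding it. -/
def UpTo (x u : M) : Prop := Below x u ∨ InTC u x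

/-- `f` is an isomorphism from the transitive closure of `x` and the sets preceding it onto a
transitive set omitting the chosen Quine atom. -/
def Stage (x f : M) : Prop :=
  IsEmb f ∧ (∀ u, (∃ v, Rel f u v) ↔ UpTo x u) ∧ ∀ q, LeastQuine q → ¬ ∃ u, Rel f u q

/-- `f` and `g` agree on the transitive closure of the sets preceding `x`. -/
def Agree (x f g : M) : Prop := ∀ u v, Below x u → (Rel f u v ↔ Rel g u v)

/-- `g` is the first candidate for stage `x` that continues `f`. -/
def Best (x f g : M) : Prop :=
  Stage x g ∧ Agree x f g ∧ ∀ g', Before g' g → ¬ (Stage x g' ∧ Agree x f g')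

/-- `f` arises up to stage `x` by taking the first possible extension at every stage. -/
def Good (x f : M) : Prop :=
  Stage x f ∧ ∀ y, Before y x ∨ y = x → ∃ g, Best y f g ∧ ∀ u v, Rel g u v → Rel f u v

/-- The graph of the embedding of the universe. -/
def EmbGraph (x y : M) : Prop := ∃ z f, Good z f ∧ Rel f x y

section Definability

variable {I : Type*} {M : I → Type u} [∀ i, memLang.Structure (M i)]
  [∀ i, choiceLang.Structure (M i)] {κ α : Type*} {p : ∀ i, κ → M i}
  {r s t : ∀ i, (α → M i) → M i} [IsTm p r] [IsTm p s] [IsTm p t]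

instance IsDef.leastQuine : IsDef p (fun i v => LeastQuine (s i v)) :=
  subst₁ (R := fun _ => LeastQuine) (by unfold LeastQuine; infer_instance)

instance IsDef.below : IsDef p (fun i v => Below (s i v) (t i v)) :=
  subst₂ (R := fun _ => Below) (by unfold Below; infer_instance)

instance IsDef.upTo : IsDef p (fun i v => UpTo (s i v) (t i v)) :=
  subst₂ (R := fun _ => UpTo) (by unfold UpTo; infer_instance)

instance IsDef.stage : IsDef p (fun i v => Stage (s i v) (t i v)) :=
  subst₂ (R := fun _ => Stage) (by unfold Stage; infer_instance)

instance IsDef.agree : IsDef p (fun i v => Agree (r i v) (s i v) (t i v)) :=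
  subst₃ (R := fun _ => Agree) (by unfold Agree; infer_instance)

instance IsDef.best : IsDef p (fun i v => Best (r i v) (s i v) (t i v)) :=
  subst₃ (R := fun _ => Best) (by unfold Best; infer_instance)

instance IsDef.good : IsDef p (fun i v => Good (s i v) (t i v)) :=
  subst₂ (R := fun _ => Good) (by unfold Good; infer_instance)

instance IsDef.embGraph : IsDef p (fun i v => EmbGraph (s i v) (t i v)) :=
  subst₂ (R := fun _ => EmbGraph) (by unfold EmbGraph; infer_instance)

end Definability

theorem Agree.symm {x f g : M} (h : Agree x f g) : Agree x g f := fun u v hu => (h u v hu).symm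

theorem Agree.trans {x f g h : M} (h₁ : Agree x f g) (h₂ : Agree x g h) : Agree x f h :=
  fun u v hu => (h₁ u v hu).trans (h₂ u v hu)

/-- The choice at stage `x` depends on `f` only through its restriction to earlier stages, which
makes the recursion coherent. -/
theorem Best.congr {x f f' g : M} (h : Best x f g) (hf : Agree x f f') : Best x f' g :=
  ⟨h.1, hf.symm.trans h.2.1, fun g' hg' hc => h.2.2 g' hg' ⟨hc.1, hf.trans hc.2⟩⟩

omit [choiceLang.Structure M] in
theorem IsEmb.eq_of_rel {f x y y' : M} (hf : IsEmb f) (h : Rel f x y) (h' : Rel f x y') : y = y' :=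
  (hf.1 _ _ _ _ h h').1.1 rfl

theorem IsEmb.agree {x f g : M} (hg : IsEmb g) (hfg : ∀ u v, Rel f u v → Rel g u v)
    (hf : ∀ u, Below x u → ∃ v, Rel f u v) : Agree x f g := fun u v hu => by
  refine ⟨hfg u v, fun h => ?_⟩
  obtain ⟨v', hv'⟩ := hf u hu
  rwa [hg.eq_of_rel h (hfg u v' hv')]

theorem UpTo.refl (x : M) : UpTo x x := .inr (.refl x)

namespace ModelsZFGC

variable (hM : ModelsZFGC M)
include hM

theorem leastQuine_unique {q q' : M} (h : LeastQuine q) (h' : LeastQuine q') : q = q' := by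
  rcases hM.before_total q q' with hb | rfl | hb
  · exact (h'.2 _ hb h.1).elim
  · rfl
  · exact (h.2 _ hb h'.1).elim

theorem exists_leastQuine (hB : BAFA M) : ∃ q : M, LeastQuine q :=
  hM.exists_least _ (hM.exists_quine hB)

theorem best_unique {x f g g' : M} (h : Best x f g) (h' : Best x f g') : g = g' := by
  rcases hM.before_total g g' with hb | rfl | hb
  · exact (h'.2.2 _ hb ⟨h.1, h.2.1⟩).elim
  · rfl
  · exact (h.2.2 _ hb ⟨h'.1, h'.2.1⟩).elim

/-- By induction on `y`: agreement at all earlier stages forces both sequences to select the same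
first candidate at `y`. -/
theorem good_agree {x x' f f' : M} (h : Good x f) (h' : Good x' f') (y : M) :
    Before y x ∨ y = x → Before y x' ∨ y = x' →
      ∀ u v, UpTo y u → (Rel f u v ↔ Rel f' u v) := by
  refine hM.before_induction (fun y => Before y x ∨ y = x → Before y x' ∨ y = x' →
    ∀ u v, UpTo y u → (Rel f u v ↔ Rel f' u v)) (fun y ih hy hy' u v hu => ?_) y
  have hlt : ∀ {x w : M}, Before y x ∨ y = x → Before w y → Before w x ∨ w = x := by
    rintro x w (h | rfl) hw
    · exact .inl (hM.before_trans hw h)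
    · exact .inl hw
  have hag : Agree y f f' := fun u v ⟨w, hw, hu⟩ =>
    ih w hw (hlt hy hw) (hlt hy' hw) u v (.inr hu)
  obtain ⟨g, hg, hgf⟩ := h.2 y hy
  obtain ⟨g', hg', hgf'⟩ := h'.2 y hy'
  obtain rfl := hM.best_unique (hg.congr hag) hg'
  obtain ⟨w, hw⟩ := (hg.1.2.1 u).2 hu
  constructor
  · intro huv
    rw [h.1.1.eq_of_rel huv (hgf _ _ hw)]
    exact hgf' _ _ hw
  · intro huv
    rw [h'.1.1.eq_of_rel huv (hgf' _ _ hw)]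
    exact hgf _ _ hw

theorem good_mono {x x' f f' : M} (h : Good x f) (h' : Good x' f') (hx : Before x x' ∨ x = x')
    {u v : M} (huv : Rel f u v) : Rel f' u v :=
  (hM.good_agree h h' x (.inr rfl) hx u v ((h.1.2.1 u).1 ⟨v, huv⟩)).1 huv

theorem good_compat {x x' f f' u v u' v' : M} (h : Good x f) (h' : Good x' f') (huv : Rel f u v)
    (huv' : Rel f' u' v') : (u = u' ↔ v = v') ∧ (u ∈ₛ u' ↔ v ∈ₛ v') := by
  rcases hM.before_total x x' with hx | rfl | hx
  · exact h'.1.1.1 _ _ _ _ (hM.good_mono h h' (.inl hx) huv) huv'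
  · exact h'.1.1.1 _ _ _ _ (hM.good_mono h h' (.inr rfl) huv) huv'
  · exact h.1.1.1 _ _ _ _ huv (hM.good_mono h' h (.inl hx) huv')

/-- If all earlier stages exist, their union is a set. -/
theorem exists_limit {x : M} (ih : ∀ w, Before w x → ∃ f, Good w f) :
    ∃ h, IsEmb h ∧ (∀ u, (∃ v, Rel h u v) ↔ Below x u) ∧
      (∀ q, LeastQuine q → ¬ ∃ u, Rel h u q) ∧
      ∀ w f, Before w x → Good w f → ∀ u v, Rel f u v → Rel h u v := by
  obtain ⟨S, hS⟩ := hM.exists_initial x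
  obtain ⟨B, hB⟩ := hM.coll S Good fun w hw => ih w ((hS w).1 hw)
  obtain ⟨U, hU⟩ := hM.union B
  obtain ⟨c, hc⟩ := hM.exists_field U
  obtain ⟨h, -, hh⟩ := hM.exists_rel c (fun u v => ∃ w f, Before w x ∧ Good w f ∧ Rel f u v) (by
    rintro u v ⟨w, f, hw, hf, huv⟩
    -- Collection may miss `f`, but any good `f'` for the same `w` contains its pairs, so the field
    -- of the union bounds them all.
    obtain ⟨f', hfB, hf'⟩ := hB w ((hS w).2 hw)
    obtain ⟨p, hp, hpf⟩ := hM.good_mono hf hf' (.inr rfl) huv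
    exact hc u v ⟨p, hp, (hU p).2 ⟨f', hfB, hpf⟩⟩)
  refine ⟨h, ⟨fun u v u' v' h1 h2 => ?_, fun u v z h1 hz => ?_, fun u v z h1 hz => ?_⟩,
    fun u => ⟨?_, ?_⟩, ?_, fun w f hw hf u v huv => (hh u v).2 ⟨w, f, hw, hf, huv⟩⟩
  · obtain ⟨w, f, hw, hf, huv⟩ := (hh _ _).1 h1
    obtain ⟨w', f', hw', hf', huv'⟩ := (hh _ _).1 h2
    exact hM.good_compat hf hf' huv huv'
  · obtain ⟨w, f, hw, hf, huv⟩ := (hh _ _).1 h1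
    obtain ⟨y, hy⟩ := hf.1.1.2.1 _ _ _ huv hz
    exact ⟨y, (hh _ _).2 ⟨w, f, hw, hf, hy⟩⟩
  · obtain ⟨w, f, hw, hf, huv⟩ := (hh _ _).1 h1
    obtain ⟨y, hy⟩ := hf.1.1.2.2 _ _ _ huv hz
    exact ⟨y, (hh _ _).2 ⟨w, f, hw, hf, hy⟩⟩
  · rintro ⟨v, hv⟩
    obtain ⟨w, f, hw, hf, huv⟩ := (hh _ _).1 hv
    rcases (hf.1.2.1 u).1 ⟨v, huv⟩ with ⟨w', hw', hu⟩ | hu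
    · exact ⟨w', hM.before_trans hw' hw, hu⟩
    · exact ⟨w, hw, hu⟩
  · rintro ⟨w, hw, hu⟩
    obtain ⟨f, hf⟩ := ih w hw
    obtain ⟨v, hv⟩ := (hf.1.2.1 u).2 (.inr hu)
    exact ⟨v, (hh _ _).2 ⟨w, f, hw, hf, hv⟩⟩
  · rintro q hq ⟨u, hu⟩
    obtain ⟨w, f, hw, hf, huv⟩ := (hh _ _).1 hu
    exact hf.1.2.2 q hq ⟨u, huv⟩

theorem exists_stage (hB : BAFA M) {x h : M} (hh : IsEmb h)
    (hdom : ∀ u, (∃ v, Rel h u v) ↔ Below x u) (hq : ∀ q, LeastQuine q → ¬ ∃ u, Rel h u q) :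
    ∃ g, Stage x g ∧ Agree x h g := by
  obtain ⟨q, hqq⟩ := hM.exists_leastQuine hB
  obtain ⟨d, hd⟩ := hM.exists_dom h
  obtain ⟨h', hh'⟩ := hM.exists_converse h
  obtain ⟨r, hr⟩ := hM.exists_dom h'
  simp only [hh'] at hr
  obtain ⟨c, hc⟩ := hM.exists_tc x
  obtain ⟨s, hs⟩ := hM.exists_union₂ d c
  obtain ⟨t, ht⟩ := hM.exists_insert r q
  obtain ⟨g, hg, hhg, hgs, hgt⟩ := hM.exists_extension hB (s := s) (t := t) hh
    (fun z y hz hy => by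
      rw [hs, hd, hc] at hy ⊢
      rcases hy with ⟨w, hw⟩ | hy
      · exact .inl (hh.2.1 y w z hw hz)
      · exact .inr (hy.of_mem hz))
    (fun w y hw hy => by
      rw [ht, hr] at hy ⊢
      rcases hy with ⟨z, hz⟩ | rfl
      · exact .inl (hh.2.2 z y w hz hw)
      · exact .inr ((hqq.1 w).1 hw))
    (fun u v huv => (hs u).2 (.inl ((hd u).2 ⟨v, huv⟩)))
    (fun u v huv => (ht v).2 (.inl ((hr v).2 ⟨u, huv⟩)))
    -- Adjoining `q` creates no clash: since `q ∈ q`, it is a subset of the range only if it is a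
    -- value already.
    (fun u hu hsub => by
      rcases (ht u).1 hu with hu | rfl
      · exact (hr u).1 hu
      · exact hsub u ((hqq.1 u).2 rfl))
  refine ⟨g, ⟨hg, fun u => ?_, fun q' hq' ⟨u, hu⟩ => ?_⟩, hg.agree hhg fun u hu => (hdom u).2 hu⟩
  · rw [hgs, hs, hd, hdom, hc, UpTo]
  · obtain rfl := hM.leastQuine_unique hq' hqq
    exact hq q' hq' (hgt u q' hu ((ht q').2 (.inr rfl)))

theorem exists_good (hB : BAFA M) (x : M) : ∃ f, Good x f := by
  refine hM.before_induction (fun x => ∃ f, Good x f) (fun x ih => ?_) x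
  obtain ⟨h, hh, hdom, hq, hext⟩ := hM.exists_limit ih
  obtain ⟨g, ⟨hg, hag⟩, hmin⟩ := hM.exists_least (fun g => Stage x g ∧ Agree x h g)
    (hM.exists_stage hB hh hdom hq)
  have hbest : Best x h g := ⟨hg, hag, hmin⟩
  have hhg : ∀ u v, Rel h u v → Rel g u v := fun u v huv =>
    (hag u v ((hdom u).1 ⟨v, huv⟩)).1 huv
  refine ⟨g, hg, fun y hy => ?_⟩
  rcases hy with hy | rfl
  · obtain ⟨f, hf⟩ := ih y hy
    have hfg : ∀ u v, Rel f u v → Rel g u v := fun u v huv => hhg u v (hext y f hy hf u v huv)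
    obtain ⟨g', hg', hgf'⟩ := hf.2 y (.inr rfl)
    -- What was best relative to `f` stays best relative to `g`, as both agree below `y`.
    exact ⟨g', hg'.congr (hg.1.agree hfg fun u hu => (hf.1.2.1 u).2 (.inl hu)),
      fun u v huv => hfg u v (hgf' u v huv)⟩
  · exact ⟨g, hbest.congr hag, fun _ _ h => h⟩

theorem exists_embGraph (hB : BAFA M) (x : M) : ∃ y, EmbGraph x y := by
  obtain ⟨f, hf⟩ := hM.exists_good hB x
  obtain ⟨y, hy⟩ := (hf.1.2.1 x).2 (.refl x)
  exact ⟨y, x, f, hf, hy⟩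

theorem isEmbRel_embGraph : IsEmbRel (EmbGraph (M := M)) := by
  refine ⟨?_, ?_, ?_⟩
  · rintro u v u' v' ⟨z, f, hf, huv⟩ ⟨z', f', hf', huv'⟩
    exact hM.good_compat hf hf' huv huv'
  · rintro u v w ⟨z, f, hf, huv⟩ hw
    exact (hf.1.1.2.1 _ _ _ huv hw).imp fun _ h => ⟨z, f, hf, h⟩
  · rintro u v w ⟨z, f, hf, huv⟩ hw
    exact (hf.1.1.2.2 _ _ _ huv hw).imp fun _ h => ⟨z, f, hf, h⟩

omit hM in
theorem _root_.BoffaTheory.LeastQuine.not_embGraph {q x : M} (hq : LeastQuine q) : ¬ EmbGraph x q :=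
  fun ⟨_, _, hf, h⟩ => hf.1.2.2 q hq ⟨x, h⟩

/-- A finite tuple has a last stage, so a single set isomorphism acts on all its entries. -/
theorem exists_bound (n : ℕ) (v : Fin n → M) : ∃ z, ∀ i, Before (v i) z ∨ v i = z := by
  induction n with
  | zero => exact hM.exists_empty.imp fun _ _ i => i.elim0
  | succ n ih =>
    obtain ⟨z, hz⟩ := ih (fun i => v i.succ)
    rcases hM.before_total (v 0) z with h | h | h
    · exact ⟨z, Fin.cases (.inl h) hz⟩
    · exact ⟨z, Fin.cases (.inr h) hz⟩
    · refine ⟨v 0, Fin.cases (.inr rfl) fun i => .inl ?_⟩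
      rcases hz i with hi | hi
      · exact hM.before_trans hi h
      · exact hi ▸ h

/-- The class function with graph `EmbGraph` is elementary in the language of set theory. -/
theorem realize_comp_iff (hB : BAFA M) {j : M → M} (hj : ∀ x, EmbGraph x (j x)) {n : ℕ}
    (φ : memLang.Formula (Fin n)) (v : Fin n → M) : φ.Realize (j ∘ v) ↔ φ.Realize v := by
  choose z f hf hv using fun i => hj (v i)
  obtain ⟨b, hb⟩ := hM.exists_bound n z
  obtain ⟨g, hg⟩ := hM.exists_good hB b
  exact (hM.realize_iff_of_isEmb hB φ hg.1.1
    (fun i => hM.good_mono (hf i) hg (hb i) (hv i)) (fun i => i.elim0)).symm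

end ModelsZFGC

/-- The embedding is defined by one and the same formula in all models. -/
theorem exists_formula_embGraph : ∃ J : gcLang.Formula (Fin 2),
    ∀ (M : Type u) [memLang.Structure M] [choiceLang.Structure M] (x y : M),
      J.Realize ![x, y] ↔ EmbGraph x y := by
  -- Indexing by all structures at once gives one formula for all models; the empty parameter type
  -- makes it parameter-free.
  let I := Σ' (M : Type u) (_ : memLang.Structure M), choiceLang.Structure M
  let _ : ∀ i : I, memLang.Structure i.1 := fun i => i.2.1
  let _ : ∀ i : I, choiceLang.Structure i.1 := fun i => i.2.2
  have : IsDef (fun (i : I) (e : Empty) => (e.elim : i.1))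
      (fun i (v : Fin 2 → i.1) => EmbGraph (v 0) (v 1)) := inferInstance
  obtain ⟨φ, hφ⟩ := this.out
  refine ⟨φ.relabel (Sum.elim Empty.elim id), fun M _ _ x y => ?_⟩
  rw [Language.Formula.realize_relabel]
  refine Iff.trans (iff_of_eq ?_) (hφ ⟨M, ‹_›, ‹_›⟩ ![x, y])
  congr 1
  funext k
  rcases k with k | k
  · exact k.elim
  · rfl

end Construction

end BoffaTheory

theorem theorem4p8 :
    ∃ J : BoffaTheory.gcLang.Formula (Fin 2),
      ∀ (M : Type u) [BoffaTheory.memLang.Structure M] [BoffaTheory.choiceLang.Structure M],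
        BoffaTheory.ModelsZFGC M → BoffaTheory.BAFA M →
        ∃ j : M ↪ₑ[BoffaTheory.memLang] M,
          (∀ x y : M, J.Realize ![x, y] ↔ j x = y) ∧
          (¬ ∃ g : M ≃[BoffaTheory.memLang] M, ∀ x, g x = j x) ∧
          ∃ F : Option M → M,
            BoffaTheory.IsTransitiveCollapse BoffaTheory.plusQuineAtom F ∧
            ∀ x, F (some x) = j x := by
  obtain ⟨J, hJ⟩ := BoffaTheory.exists_formula_embGraph.{u}
  refine ⟨J, fun M _ _ hM hB => ?_⟩
  choose j hj using hM.exists_embGraph hB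
  obtain ⟨q, hq⟩ := hM.exists_leastQuine hB
  have hemb := hM.isEmbRel_embGraph
  have hjq : ∀ x, j x ≠ q := fun x h => hq.not_embGraph (h ▸ hj x)
  have htrans : ∀ z x, BoffaTheory.Mem z (j x) → ∃ y, j y = z := fun z x hz => by
    obtain ⟨y, hy⟩ := hemb.2.2 _ _ _ (hj x) hz
    exact ⟨y, (hemb.1 _ _ _ _ (hj y) hy).1.1 rfl⟩
  refine ⟨⟨j, fun n φ v => hM.realize_comp_iff hB hj φ v⟩, fun x y => ?_, ?_,
    -- The extra atom goes to the omitted `q`. No `j y` contains `q`, as the range of `j` is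
    -- transitive, and `q` contains no `j x`, as its only member is `q`.
    fun o => o.elim q j, ⟨?_, ?_, ?_⟩, fun x => rfl⟩
  · rw [hJ]
    exact ⟨fun h => (hemb.1 _ _ _ _ (hj x) h).1.1 rfl, fun h => h ▸ hj x⟩
  · rintro ⟨g, hg⟩
    obtain ⟨x, hx⟩ := g.surjective q
    exact hjq x ((hg x).symm.trans hx)
  · rintro (_ | x) (_ | y) h
    · rfl
    · exact (hjq y h.symm).elim
    · exact (hjq x h).elim
    · exact congrArg some ((hemb.1 _ _ _ _ (hj x) (hj y)).1.2 h)
  · rintro (_ | x) (_ | y)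
    · exact iff_of_true trivial ((hq.1 q).2 rfl)
    · refine iff_of_false id fun h => ?_
      obtain ⟨z, hz⟩ := htrans q y h
      exact hjq z hz
    · exact iff_of_false id fun h => hjq x ((hq.1 _).1 h)
    · exact (hemb.1 _ _ _ _ (hj x) (hj y)).2
  · rintro z (_ | x) hz
    · exact ⟨none, ((hq.1 z).1 hz).symm⟩
    · obtain ⟨y, hy⟩ := htrans z x hz
      exact ⟨some y, hy⟩
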